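/- Let $\mathbb K$ be a field with $\operatorname{char}\mathbb K\neq 2$, and let $X=\{1,2,3,4\}$ be the tetrahedral quandle, whose left translations $g_t\colon s\mapsto t\triangleright s$ are the 3-cycles $$g_1=(2\,3\,4),\quad g_2=(1\,4\,3),\quad g_3=(1\,2\,4),\quad g_4=(1\,3\,2).$$ Let $\operatorname{Inn}X=\langle g_1,g_2,g_3,g_4\rangle\le \mathfrak S_4$ and $\operatorname{Env}X=\langle t\in X\mid s\,t=(s\triangleright t)\,s\ \ \forall s,t\in X\rangle$. Let $V=\mathbb K X$ have basis $(e_t)_{t\in X}$ and the braiding $c(e_t\otimes e_s)=-\,e_{t\triangleright s}\otimes e_t$ (constant cocycle $-1$), extended to the tensor algebra $TV$ with multiplication $\mu$. Let $\Delta\colon TV\to TV\otimes TV$ be the braided comultiplication, determined by $\Delta\mu=(\mu\otimes\mu)(\mathrm{id}\otimes c\otimes\mathrm{id})(\Delta\otimes\Delta)$ and by all $e_t$ being primitive. Let $\mathfrak B=TV/I$ be the Nichols algebra of $V$, where $I$ is the largest homogeneous two-sided ideal of $TV$ that lies in degrees $\ge 2$ and satisfies $\Delta(I)\subseteq I\otimes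 TV+TV\otimes I$. It is $\operatorname{Env}X$-graded, $e_t$ having degree $t$. A surjective homomorphism $\pi\colon\operatorname{Env}X\to G$ induces a $G$-grading with components $\mathfrak B(g)=\sum_{\pi(x)=g}\mathfrak B(x)$; it is called balanced if $\dim\mathfrak B(g)$ is finite and the same for all $g\in G$. Then there is no quotient group $G$ of $\operatorname{Env}X$ such that $\operatorname{Inn}X$ is a quotient of $G$ and $\mathfrak B$ is $G$-balanced with respect to the induced grading. -/

import Mathlib

open scoped TensorProduct Quandles

noncomputable section

namespace RackNichols

/-! ### Racks and their groups -/

/-- The inner group `Inn X` of a rack: the group of permutations of `X` generated by the left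
translations `g_t : s ↦ t ◃ s`. -/
def Inn (X : Type*) [Rack X] : Subgroup (Equiv.Perm X) :=
  Subgroup.closure (Set.range (Rack.act' : X → Equiv.Perm X))

/-- The generator of the enveloping group
`Env X = ⟨t ∈ X | s t = (s ◃ t) s⟩` given by `t ∈ X`. -/
def envGen {X : Type*} [Rack X] (t : X) : Rack.EnvelGroup X :=
  Rack.toEnvelGroup X t

/-! ### The braided tensor algebra of `V = K X`

`V` has basis `(e_t)_{t ∈ X}`, so its tensor algebra `TV` is the free algebra on `X`, and `e_t` is
`FreeAlgebra.ι K t`. -/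

section Tensor

variable (K : Type*) [Field K] {X : Type*} [Rack X] (χ : X → X → K)

/-- The action of `g_t` on `TV` by algebra endomorphisms, `e_s ↦ χ(t, s) e_{t ◃ s}`. -/
def gAct (t : X) : FreeAlgebra K X →ₐ[K] FreeAlgebra K X :=
  FreeAlgebra.lift K fun s => χ t s • FreeAlgebra.ι K (t ◃ s)

/-- The algebra homomorphism `TV → End (TV ⊗ TV)` with `e_t ↦ (w ⊗ d ↦ g_t w ⊗ e_t d)`; the
product `v` of `e_{t₁}, …, e_{tₙ}` acts as `w ⊗ d ↦ (g_{t₁} ⋯ g_{tₙ} w) ⊗ v d`. -/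
def braidOp : FreeAlgebra K X →ₐ[K] Module.End K (FreeAlgebra K X ⊗[K] FreeAlgebra K X) :=
  FreeAlgebra.lift K fun t =>
    TensorProduct.map (gAct K χ t).toLinearMap (LinearMap.mulLeft K (FreeAlgebra.ι K t))

/-- The braiding `c` of `TV`: `c (v ⊗ w) = (g_{t₁} ⋯ g_{tₙ} w) ⊗ v` for `v = e_{t₁} ⋯ e_{tₙ}`;
on `V ⊗ V` it is `c (e_t ⊗ e_s) = χ(t, s) e_{t ◃ s} ⊗ e_t`. -/
def braiding :
    FreeAlgebra K X ⊗[K] FreeAlgebra K X →ₗ[K] FreeAlgebra K X ⊗[K] FreeAlgebra K X :=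
  TensorProduct.lift
    (((TensorProduct.mk K (FreeAlgebra K X) (FreeAlgebra K X)).flip 1).lcomp K
        (FreeAlgebra K X ⊗[K] FreeAlgebra K X) ∘ₗ (braidOp K χ).toLinearMap)

theorem braiding_tmul (v w : FreeAlgebra K X) :
    braiding K χ (v ⊗ₜ[K] w) = braidOp K χ v (w ⊗ₜ[K] 1) := rfl

theorem braiding_ι_tmul (t : X) (w : FreeAlgebra K X) :
    braiding K χ (FreeAlgebra.ι K t ⊗ₜ[K] w) = gAct K χ t w ⊗ₜ[K] FreeAlgebra.ι K t := by
  simp [braiding_tmul, braidOp]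

/-- The braided multiplication `(μ ⊗ μ) (id ⊗ c ⊗ id)` of `TV ⊗ TV`. -/
def braidedMul :
    (FreeAlgebra K X ⊗[K] FreeAlgebra K X) ⊗[K] (FreeAlgebra K X ⊗[K] FreeAlgebra K X) →ₗ[K]
      FreeAlgebra K X ⊗[K] FreeAlgebra K X :=
  TensorProduct.map (LinearMap.mul' K (FreeAlgebra K X)) (LinearMap.mul' K (FreeAlgebra K X)) ∘ₗ
    (TensorProduct.assoc K (FreeAlgebra K X) (FreeAlgebra K X)
      (FreeAlgebra K X ⊗[K] FreeAlgebra K X)).symm.toLinearMap ∘ₗ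
    (TensorProduct.map LinearMap.id
      ((TensorProduct.assoc K (FreeAlgebra K X) (FreeAlgebra K X) (FreeAlgebra K X)).toLinearMap ∘ₗ
        TensorProduct.map (braiding K χ) LinearMap.id ∘ₗ
        (TensorProduct.assoc K (FreeAlgebra K X) (FreeAlgebra K X)
          (FreeAlgebra K X)).symm.toLinearMap)) ∘ₗ
    (TensorProduct.assoc K (FreeAlgebra K X) (FreeAlgebra K X)
      (FreeAlgebra K X ⊗[K] FreeAlgebra K X)).toLinearMap

/-- Left braided multiplication with `Δ e_t = e_t ⊗ 1 + 1 ⊗ e_t`, for every `t`, extended to an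
algebra homomorphism on `TV`. -/
def comulOp : FreeAlgebra K X →ₐ[K] Module.End K (FreeAlgebra K X ⊗[K] FreeAlgebra K X) :=
  FreeAlgebra.lift K fun t =>
    braidedMul K χ ∘ₗ TensorProduct.mk K (FreeAlgebra K X ⊗[K] FreeAlgebra K X)
      (FreeAlgebra K X ⊗[K] FreeAlgebra K X)
      (FreeAlgebra.ι K t ⊗ₜ[K] 1 + 1 ⊗ₜ[K] FreeAlgebra.ι K t)

/-- The braided comultiplication `Δ : TV → TV ⊗ TV`. It is multiplicative for the braided
multiplication (`comul_mul`), and the `e_t` are primitive (`comul_ι`). -/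
def comul : FreeAlgebra K X →ₗ[K] FreeAlgebra K X ⊗[K] FreeAlgebra K X :=
  LinearMap.applyₗ (1 ⊗ₜ[K] 1) ∘ₗ (comulOp K χ).toLinearMap

theorem braidOp_mulRight (b d : FreeAlgebra K X) (z : FreeAlgebra K X ⊗[K] FreeAlgebra K X) :
    braidOp K χ b (TensorProduct.map LinearMap.id (LinearMap.mulRight K d) z) =
      TensorProduct.map LinearMap.id (LinearMap.mulRight K d) (braidOp K χ b z) := by
  induction b using FreeAlgebra.induction generalizing z with
  | grade0 r => simp [Algebra.algebraMap_eq_smul_one]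
  | grade1 t =>
    induction z using TensorProduct.induction_on with
    | zero => simp
    | tmul x y => simp [braidOp, mul_assoc]
    | add x y hx hy => simp only [map_add, hx, hy]
  | mul a b ha hb => simp only [map_mul, Module.End.mul_apply, ha, hb]
  | add a b ha hb => simp only [map_add, LinearMap.add_apply, ha, hb]

theorem braidedMul_tmul (a b : FreeAlgebra K X) (z : FreeAlgebra K X ⊗[K] FreeAlgebra K X) :
    braidedMul K χ ((a ⊗ₜ[K] b) ⊗ₜ[K] z) =
      TensorProduct.map (LinearMap.mulLeft K a) LinearMap.id (braidOp K χ b z) := by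
  induction z using TensorProduct.induction_on with
  | zero => simp
  | add x y hx hy => simp only [TensorProduct.tmul_add, map_add, hx, hy]
  | tmul c d =>
    have h : braidOp K χ b (c ⊗ₜ[K] d) =
        TensorProduct.map LinearMap.id (LinearMap.mulRight K d) (braiding K χ (b ⊗ₜ[K] c)) := by
      rw [braiding_tmul, ← braidOp_mulRight]
      simp
    rw [h]
    simp only [braidedMul, LinearMap.comp_apply, LinearEquiv.coe_coe, TensorProduct.assoc_tmul,
      TensorProduct.map_tmul, LinearMap.id_apply, TensorProduct.assoc_symm_tmul]
    induction braiding K χ (b ⊗ₜ[K] c) using TensorProduct.induction_on with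
    | zero => simp
    | tmul x y => simp
    | add x y hx hy => simp only [TensorProduct.add_tmul, TensorProduct.tmul_add, map_add, hx, hy]

theorem comulOp_ι_tmul (t : X) (a b : FreeAlgebra K X) :
    comulOp K χ (FreeAlgebra.ι K t) (a ⊗ₜ[K] b) =
      (FreeAlgebra.ι K t * a) ⊗ₜ[K] b + gAct K χ t a ⊗ₜ[K] (FreeAlgebra.ι K t * b) := by
  simp [comulOp, braidedMul_tmul, braidOp]

theorem comul_one : comul K χ 1 = 1 ⊗ₜ[K] 1 := by
  simp [comul]

theorem comul_ι (t : X) :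
    comul K χ (FreeAlgebra.ι K t) =
      FreeAlgebra.ι K t ⊗ₜ[K] 1 + 1 ⊗ₜ[K] FreeAlgebra.ι K t := by
  simp [comul, comulOp_ι_tmul]

theorem comulOp_braidedMul (x : FreeAlgebra K X)
    (y z : FreeAlgebra K X ⊗[K] FreeAlgebra K X) :
    comulOp K χ x (braidedMul K χ (y ⊗ₜ[K] z)) =
      braidedMul K χ (comulOp K χ x y ⊗ₜ[K] z) := by
  induction x using FreeAlgebra.induction generalizing y with
  | grade0 r => simp [Algebra.algebraMap_eq_smul_one, ← TensorProduct.smul_tmul']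
  | grade1 t =>
    induction y using TensorProduct.induction_on with
    | zero => simp
    | add x y hx hy => simp only [map_add, TensorProduct.add_tmul, hx, hy]
    | tmul a b =>
      rw [comulOp_ι_tmul, TensorProduct.add_tmul, map_add, braidedMul_tmul, braidedMul_tmul,
        braidedMul_tmul, map_mul, Module.End.mul_apply]
      induction braidOp K χ b z using TensorProduct.induction_on with
      | zero => simp
      | tmul c d => simp [comulOp_ι_tmul, braidOp]
      | add c d hc hd =>
        simp only [map_add, hc, hd]
        abel
  | mul a b ha hb => simp only [map_mul, Module.End.mul_apply, ha, hb]
  | add a b ha hb => simp only [map_add, LinearMap.add_apply, ha, hb, TensorProduct.add_tmul]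

/-- `Δ μ = (μ ⊗ μ) (id ⊗ c ⊗ id) (Δ ⊗ Δ)`. -/
theorem comul_mul (x y : FreeAlgebra K X) :
    comul K χ (x * y) = braidedMul K χ (comul K χ x ⊗ₜ[K] comul K χ y) := by
  have h : ∀ z, braidedMul K χ ((1 ⊗ₜ[K] 1) ⊗ₜ[K] z) = z := fun z => by
    simp [braidedMul_tmul]
  have e : ∀ x, comul K χ x = comulOp K χ x (1 ⊗ₜ[K] 1) := fun _ => rfl
  rw [e (x * y), map_mul, Module.End.mul_apply, ← e y, e x, ← comulOp_braidedMul, h]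

end Tensor

/-! ### The Nichols algebra -/

section Nichols

variable (K : Type*) [Field K] {X : Type*}

/-- The monomial `e_{t₁} ⋯ e_{tₙ}`. -/
def word (l : List X) : FreeAlgebra K X :=
  (l.map (FreeAlgebra.ι K)).prod

/-- The component of degree `n` of `TV`. -/
def degreePart (n : ℕ) : Submodule K (FreeAlgebra K X) :=
  Submodule.span K (word K '' {l | l.length = n})

/-- The subspace `J ⊗ TV + TV ⊗ J` of `TV ⊗ TV`. -/
def idealTensor (J : Ideal (FreeAlgebra K X)) :
    Submodule K (FreeAlgebra K X ⊗[K] FreeAlgebra K X) :=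
  LinearMap.range (TensorProduct.map (J.restrictScalars K).subtype
      (LinearMap.id : FreeAlgebra K X →ₗ[K] FreeAlgebra K X)) ⊔
    LinearMap.range (TensorProduct.map
      (LinearMap.id : FreeAlgebra K X →ₗ[K] FreeAlgebra K X) (J.restrictScalars K).subtype)

theorem idealTensor_mono {I J : Ideal (FreeAlgebra K X)}
    (h : I.restrictScalars K ≤ J.restrictScalars K) : idealTensor K I ≤ idealTensor K J := by
  refine sup_le_sup ?_ ?_
  · rintro _ ⟨z, rfl⟩
    refine ⟨TensorProduct.map (Submodule.inclusion h) LinearMap.id z, ?_⟩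
    rw [← LinearMap.comp_apply, ← TensorProduct.map_comp]
    rfl
  · rintro _ ⟨z, rfl⟩
    refine ⟨TensorProduct.map LinearMap.id (Submodule.inclusion h) z, ?_⟩
    rw [← LinearMap.comp_apply, ← TensorProduct.map_comp]
    rfl

variable [Rack X] (χ : X → X → K)

/-- `J` is a homogeneous two-sided ideal and coideal of `TV` contained in the part of degree at
least 2: `Δ J ⊆ J ⊗ TV + TV ⊗ J`. -/
structure IsNicholsCandidate (J : Ideal (FreeAlgebra K X)) : Prop where
  twoSided : J.IsTwoSided
  homogeneous : J.restrictScalars K ≤ ⨆ n, J.restrictScalars K ⊓ degreePart K n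
  degree : J.restrictScalars K ≤ ⨆ n ≥ 2, degreePart K n
  coideal : ∀ x ∈ J, comul K χ x ∈ idealTensor K J

/-- The maximal homogeneous ideal and coideal of `TV` in degrees at least 2, obtained as the sum of
all of them. -/
def nicholsIdeal : Ideal (FreeAlgebra K X) :=
  sSup {J | IsNicholsCandidate K χ J}

theorem nicholsIdeal_isGreatest :
    IsGreatest {J : Ideal (FreeAlgebra K X) | IsNicholsCandidate K χ J} (nicholsIdeal K χ) := by
  have hle : ∀ J : Ideal (FreeAlgebra K X), IsNicholsCandidate K χ J → J ≤ nicholsIdeal K χ :=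
    fun J hJ => le_sSup hJ
  refine ⟨?_, fun J hJ => hle J hJ⟩
  have key : ∀ P : FreeAlgebra K X → Prop, P 0 → (∀ x y, P x → P y → P (x + y)) →
      (∀ J, IsNicholsCandidate K χ J → ∀ x ∈ J, P x) → ∀ x ∈ nicholsIdeal K χ, P x := by
    intro P h0 hadd hP x hx
    rw [nicholsIdeal, sSup_eq_iSup'] at hx
    exact Submodule.iSup_induction _ (motive := P) hx (fun J y hy => hP J.1 J.2 y hy) h0 hadd
  refine ⟨⟨fun {a} b ha => ?_⟩, fun x hx => ?_, fun x hx => ?_, fun x hx => ?_⟩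
  · refine key (fun a => a * b ∈ nicholsIdeal K χ) (by simp)
      (fun x y hx hy => by rw [add_mul]; exact add_mem hx hy) (fun J hJ x hx => ?_) a ha
    exact hle J hJ (hJ.twoSided.mul_mem_of_left b hx)
  · refine key (fun x => x ∈ ⨆ n, (nicholsIdeal K χ).restrictScalars K ⊓ degreePart K n)
      (zero_mem _) (fun x y hx hy => add_mem hx hy) (fun J hJ x hx => ?_) x hx
    have hi : J.restrictScalars K ≤ (nicholsIdeal K χ).restrictScalars K :=
      fun y hy => hle J hJ hy
    exact (hJ.homogeneous.trans (iSup_mono fun n => inf_le_inf_right (degreePart K n) hi)) hx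
  · exact key (fun x => x ∈ ⨆ n ≥ 2, degreePart K n)
      (zero_mem _) (fun x y hx hy => add_mem hx hy) (fun J hJ x hx => hJ.degree hx) x hx
  · refine key (fun x => comul K χ x ∈ _) (by simp)
      (fun x y hx hy => by rw [map_add]; exact add_mem hx hy) (fun J hJ x hx => ?_) x hx
    have hi : J.restrictScalars K ≤ (nicholsIdeal K χ).restrictScalars K :=
      fun y hy => hle J hJ hy
    exact idealTensor_mono K hi (hJ.coideal x hx)

instance : (nicholsIdeal K χ).IsTwoSided := (nicholsIdeal_isGreatest K χ).1.twoSided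

/-- The Nichols algebra `TV / I` of the rack `X` and the (scalar) 2-cocycle `χ`. -/
abbrev NicholsAlgebra : Type _ :=
  FreeAlgebra K X ⧸ nicholsIdeal K χ

/-- The component of degree `x ∈ Env X` of the Nichols algebra, where `e_t` has degree `t`: it is
spanned by the images of the monomials `e_{t₁} ⋯ e_{tₙ}` with `t₁ ⋯ tₙ = x` in `Env X`. -/
def envComponent (x : Rack.EnvelGroup X) : Submodule K (NicholsAlgebra K χ) :=
  Submodule.span K
    ((fun l : List X => (Ideal.Quotient.mk (nicholsIdeal K χ) (word K l) : NicholsAlgebra K χ)) ''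
      {l | (l.map envGen).prod = x})

/-- The component of degree `g ∈ G` for the grading of the Nichols algebra that a homomorphism
`π : Env X → G` induces. -/
def component {G : Type*} [Group G] (π : Rack.EnvelGroup X →* G) (g : G) :
    Submodule K (NicholsAlgebra K χ) :=
  ⨆ x : {x : Rack.EnvelGroup X // π x = g}, envComponent K χ x

end Nichols

/-- A family of homogeneous components is balanced if all of them have the same finite
dimension. -/
def IsBalanced (K : Type*) [Field K] {G U : Type*} [AddCommGroup U] [Module K U]
    (A : G → Submodule K U) : Prop :=
  ∃ d : ℕ, ∀ g, FiniteDimensional K (A g) ∧ Module.finrank K (A g) = d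

/-! ### The tetrahedral quandle -/

/-- The underlying set of the tetrahedral quandle; the elements `1, 2, 3, 4` of the usual
operation table are written `0, 1, 2, 3`. -/
def Tetra : Type := Fin 4

/-- The operation table of the tetrahedral quandle. -/
def tetraAct (x y : Fin 4) : Fin 4 :=
  !![0, 2, 3, 1;
     3, 1, 0, 2;
     1, 3, 2, 0;
     2, 0, 1, 3] x y

instance : Quandle Tetra where
  act := tetraAct
  self_distrib {x y z} :=
    (by decide : ∀ x y z : Fin 4,
      tetraAct x (tetraAct y z) = tetraAct (tetraAct x y) (tetraAct x z)) x y z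
  invAct x y := tetraAct x (tetraAct x y)
  left_inv x y := (by decide : ∀ x y : Fin 4, tetraAct x (tetraAct x (tetraAct x y)) = y) x y
  right_inv x y := (by decide : ∀ x y : Fin 4, tetraAct x (tetraAct x (tetraAct x y)) = y) x y
  fix {x} := (by decide : ∀ x : Fin 4, tetraAct x x = x) x

end RackNichols
end

open scoped TensorProduct Quandles

noncomputable section

namespace RackNichols

/-! ### Skew derivations of the tensor algebra -/

section Functionals

variable {K : Type*} [Field K] {X : Type*}

/-! The point is to compare two components of the coarsest grading, by `Inn X`. Let `σ = ρ ∘ π`. The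
kernel of the canonical map from `Env X` to `Inn X` is central, and only the identity commutes with
all left translations, so `σ` kills it; since both maps are onto the same finite group, the kernels
agree (`ker_eq_ker_envelAction`). Hence the union of the degrees in a fibre of `ρ` is one degree of
the grading by left translations. All fibres of `ρ` are cosets of its kernel, so a balanced `𝔅`
would have equal dimensions in all degrees of `Inn X`. This fails: with letters `0, 1, 2, 3`, the
component of the double transposition `(0 1)(2 3)` has dimension at most 4 (`finrank_le_four`),
while that of the identity has dimension at least 5 (`five_le_finrank`).

Both bounds rest on `mem_nicholsIdeal`: the Nichols ideal is the common kernel of the functionals `ε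
∂_{tₙ} ⋯ ∂_{t₁}`, where `∂_t` are the skew derivations. For the upper bound, explicit integral
tables define left multiplications and skew derivatives on a space with 72 basis vectors. They
satisfy the twisted Leibniz rule, so the kernel of `TV → model` lies in the Nichols ideal and `𝔅` is
a quotient of the image; it then suffices to count basis vectors of the given degree. For the lower
bound, five words of trivial degree are paired with five functionals, with a diagonal matrix of
signs. -/

theorem freeAlgebra_induction_left {P : FreeAlgebra K X → Prop} (one : P 1)
    (mul : ∀ s v, P v → P (FreeAlgebra.ι K s * v)) (add : ∀ u v, P u → P v → P (u + v))
    (smul : ∀ (r : K) v, P v → P (r • v)) (v : FreeAlgebra K X) : P v := by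
  -- Quantifying over the right factor makes the case of a product a composition of two steps.
  have h : ∀ a v, P v → P (a * v) := by
    intro a
    induction a using FreeAlgebra.induction with
    | grade0 r =>
      intro v hv
      rw [← Algebra.smul_def]
      exact smul r v hv
    | grade1 t => exact mul t
    | mul a b ha hb =>
      intro v hv
      rw [mul_assoc]
      exact ha _ (hb _ hv)
    | add a b ha hb =>
      intro v hv
      rw [add_mul]
      exact add _ _ (ha _ hv) (hb _ hv)
  simpa using h v 1 one

/-- The counit of `TV`. -/
def counit : FreeAlgebra K X →ₐ[K] K := FreeAlgebra.lift K fun _ => 0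

@[simp]
theorem counit_ι (t : X) : counit (FreeAlgebra.ι K t) = 0 := by
  simp [counit]

theorem counit_word (l : List X) (hl : l ≠ []) : counit (word K l) = 0 := by
  cases l with
  | nil => exact absurd rfl hl
  | cons s l => simp [word]

theorem word_nil : word K ([] : List X) = 1 := rfl

theorem word_cons (s : X) (l : List X) : word K (s :: l) = FreeAlgebra.ι K s * word K l := rfl

theorem span_range_word : Submodule.span K (Set.range (word K : List X → _)) = ⊤ := by
  rw [eq_top_iff]
  rintro v -
  induction v using freeAlgebra_induction_left with
  | one => exact Submodule.subset_span ⟨[], rfl⟩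
  | mul s v hv =>
    induction hv using Submodule.span_induction with
    | mem x hx =>
      obtain ⟨l, rfl⟩ := hx
      exact Submodule.subset_span ⟨s :: l, rfl⟩
    | zero => simp
    | add x y _ _ hx hy => rw [mul_add]; exact add_mem hx hy
    | smul a x _ hx => rw [mul_smul_comm]; exact Submodule.smul_mem _ _ hx
  | add u v hu hv => exact add_mem hu hv
  | smul r v hv => exact Submodule.smul_mem _ _ hv

variable [DecidableEq X]

/-- The coefficient of the letter `e_t`. -/
def letterCoeff (t : X) : FreeAlgebra K X →ₗ[K] K :=
  TrivSqZeroExt.sndHom K K ∘ₗ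
    (FreeAlgebra.lift K fun s => if s = t then (DualNumber.eps : DualNumber K) else 0).toLinearMap

theorem letterCoeff_one (t : X) : letterCoeff t (1 : FreeAlgebra K X) = 0 := by
  simp [letterCoeff]

theorem letterCoeff_ι_mul (t s : X) (a : FreeAlgebra K X) :
    letterCoeff t (FreeAlgebra.ι K s * a) = if s = t then counit a else 0 := by
  -- The dual-number homomorphism reduces to the counit modulo `eps`, so multiplying by `eps` moves
  -- the counit into the `eps`-coefficient.
  have h : ∀ a, (FreeAlgebra.lift K
      (fun s => if s = t then (DualNumber.eps : DualNumber K) else 0) a).fst = counit a := by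
    intro a
    have : (TrivSqZeroExt.fstHom K K K).comp (FreeAlgebra.lift K
        (fun s => if s = t then (DualNumber.eps : DualNumber K) else 0)) = counit := by
      ext s
      by_cases hs : s = t <;> simp [hs, counit]
    exact DFunLike.congr_fun this a
  by_cases hs : s = t
  · simp [letterCoeff, hs, h]
  · simp [letterCoeff, hs]

theorem letterCoeff_word (t : X) (l : List X) (hl : 2 ≤ l.length) :
    letterCoeff t (word K l) = 0 := by
  match l with
  | s :: r :: l => simp [word_cons, letterCoeff_ι_mul]

end Functionals

section Derivations

variable {K : Type*} [Field K] {X : Type*} [Rack X] (q : K)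

theorem act_eq_iff_eq_invAct {s p t : X} : s ◃ p = t ↔ p = s ◃⁻¹ t := by
  rw [← Rack.left_cancel s (y := p), Rack.act_invAct_eq]

theorem counit_gAct (s : X) (a : FreeAlgebra K X) :
    counit (gAct K (fun _ _ => q) s a) = counit a := by
  have : counit.comp (gAct K (fun _ _ : X => q) s) = counit := by
    ext t
    simp [gAct]
  exact DFunLike.congr_fun this a

theorem gAct_ι (s t : X) : gAct K (fun _ _ => q) s (FreeAlgebra.ι K t) =
    q • FreeAlgebra.ι K (s ◃ t) := by
  simp [gAct]

theorem comul_ι_mul (s : X) (v : FreeAlgebra K X) :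
    comul K (fun _ _ => q) (FreeAlgebra.ι K s * v) =
      comulOp K (fun _ _ => q) (FreeAlgebra.ι K s) (comul K (fun _ _ => q) v) := by
  simp [comul]

theorem counit_comul (v : FreeAlgebra K X) :
    TensorProduct.lid K _ (TensorProduct.map counit.toLinearMap LinearMap.id
      (comul K (fun _ _ => q) v)) = v := by
  induction v using freeAlgebra_induction_left with
  | one => simp [comul_one]
  | mul s v hv =>
    have h : ∀ z, TensorProduct.lid K _ (TensorProduct.map counit.toLinearMap LinearMap.id
        (comulOp K (fun _ _ => q) (FreeAlgebra.ι K s) z)) = FreeAlgebra.ι K s *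
        TensorProduct.lid K (FreeAlgebra K X)
          (TensorProduct.map counit.toLinearMap LinearMap.id z) := by
      intro z
      induction z using TensorProduct.induction_on with
      | zero => simp
      | tmul a b => simp [comulOp_ι_tmul, counit_gAct]
      | add a b ha hb => simp only [map_add, ha, hb, mul_add]
    rw [comul_ι_mul, h, hv]
  | add u v hu hv => simp only [map_add, hu, hv]
  | smul r v hv => simp only [map_smul, hv]

variable [DecidableEq X]

theorem letterCoeff_gAct (s t : X) (a : FreeAlgebra K X) :
    letterCoeff t (gAct K (fun _ _ => q) s a) = q * letterCoeff (s ◃⁻¹ t) a := by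
  induction a using freeAlgebra_induction_left with
  | one => simp [letterCoeff_one]
  | mul p v hv =>
    rw [map_mul, gAct_ι, smul_mul_assoc, map_smul, letterCoeff_ι_mul, letterCoeff_ι_mul,
      counit_gAct, smul_eq_mul]
    simp only [act_eq_iff_eq_invAct]
  | add u v hu hv => simp only [map_add, hu, hv, mul_add]
  | smul r v hv => simp only [map_smul, hv, smul_eq_mul]; ring

/-- The skew derivation `(e_t^* ⊗ id) Δ` of `TV`. -/
def skewDer (t : X) : FreeAlgebra K X →ₗ[K] FreeAlgebra K X :=
  (TensorProduct.lid K (FreeAlgebra K X)).toLinearMap ∘ₗ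
    TensorProduct.map (letterCoeff t) LinearMap.id ∘ₗ comul K fun _ _ => q

theorem skewDer_one (t : X) : skewDer q t (1 : FreeAlgebra K X) = 0 := by
  simp [skewDer, comul_one, letterCoeff_one]

/-- The twisted Leibniz rule. In `Δ(e_s) Δ(v)` the terms `e_s a ⊗ b` contribute `δ_{st} ε(a) b`,
which sum to `v` by the counit axiom; the terms `g_s a ⊗ e_s b` contribute the rest, because `e_t^*
∘ g_s` is `q` times the coefficient of the letter `s ◃⁻¹ t`. -/
theorem skewDer_ι_mul (t s : X) (v : FreeAlgebra K X) :
    skewDer q t (FreeAlgebra.ι K s * v) =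
      (if s = t then v else 0) + q • (FreeAlgebra.ι K s * skewDer q (s ◃⁻¹ t) v) := by
  have h : ∀ z, TensorProduct.lid K _ (TensorProduct.map (letterCoeff t) LinearMap.id
      (comulOp K (fun _ _ => q) (FreeAlgebra.ι K s) z)) =
      (if s = t then TensorProduct.lid K (FreeAlgebra K X)
        (TensorProduct.map counit.toLinearMap LinearMap.id z) else 0) +
      q • (FreeAlgebra.ι K s * TensorProduct.lid K (FreeAlgebra K X)
        (TensorProduct.map (letterCoeff (s ◃⁻¹ t)) LinearMap.id z)) := by
    intro z
    induction z using TensorProduct.induction_on with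
    | zero => simp
    | tmul a b =>
      by_cases hs : s = t <;>
      simp [comulOp_ι_tmul, letterCoeff_gAct, letterCoeff_ι_mul, hs, mul_smul]
    | add a b ha hb =>
      simp only [map_add, ha, hb, mul_add, smul_add]
      split_ifs <;> abel
  simp only [skewDer, LinearMap.comp_apply, LinearEquiv.coe_coe, comul_ι_mul, h, counit_comul]

theorem skewDer_ι (t s : X) :
    skewDer q t (FreeAlgebra.ι K s) = if s = t then 1 else 0 := by
  simpa [skewDer_one] using skewDer_ι_mul q t s 1

theorem skewDer_gAct (s t : X) (a : FreeAlgebra K X) :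
    skewDer q t (gAct K (fun _ _ => q) s a) =
      q • gAct K (fun _ _ => q) s (skewDer q (s ◃⁻¹ t) a) := by
  induction a using freeAlgebra_induction_left generalizing t with
  | one => simp [skewDer_one]
  | mul p v hv =>
    have h1 : s ◃⁻¹ ((s ◃ p) ◃⁻¹ t) = p ◃⁻¹ (s ◃⁻¹ t) := by
      rw [← act_eq_iff_eq_invAct, ← act_eq_iff_eq_invAct, Rack.self_distrib,
        Rack.act_invAct_eq, Rack.act_invAct_eq]
    rw [map_mul, gAct_ι, smul_mul_assoc, map_smul, skewDer_ι_mul, skewDer_ι_mul, hv, h1]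
    simp only [act_eq_iff_eq_invAct, map_add, map_smul, map_mul, gAct_ι]
    split_ifs <;> simp [smul_add]
  | add u v hu hv => simp only [map_add, hu, hv, smul_add]
  | smul r v hv => simp only [map_smul, hv, smul_comm r q]

/-- The only instance of coassociativity that is needed. Both sides obey the same recursion under
left multiplication by a letter. -/
theorem comul_skewDer (t : X) (v : FreeAlgebra K X) :
    comul K (fun _ _ => q) (skewDer q t v) =
      TensorProduct.map (skewDer q t) LinearMap.id (comul K (fun _ _ => q) v) := by
  induction v using freeAlgebra_induction_left generalizing t with
  | one => simp [skewDer_one, comul_one]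
  | mul s v hv =>
    have h : ∀ z, TensorProduct.map (skewDer q t) LinearMap.id
        (comulOp K (fun _ _ => q) (FreeAlgebra.ι K s) z) =
        (if s = t then z else 0) + q • comulOp K (fun _ _ => q) (FreeAlgebra.ι K s)
          (TensorProduct.map (skewDer q (s ◃⁻¹ t)) LinearMap.id z) := by
      intro z
      induction z using TensorProduct.induction_on with
      | zero => simp
      | tmul a b =>
        by_cases hs : s = t <;>
        simp [comulOp_ι_tmul, skewDer_gAct, skewDer_ι_mul, hs, TensorProduct.smul_tmul',
          TensorProduct.add_tmul, add_assoc]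
      | add a b ha hb =>
        simp only [map_add, ha, hb, smul_add]
        split_ifs <;> abel
    rw [comul_ι_mul, h, skewDer_ι_mul, map_add, map_smul, comul_ι_mul, hv]
    split_ifs <;> simp
  | add u v hu hv => simp only [map_add, hu, hv]
  | smul r v hv => simp only [map_smul, hv]

/-- The functional `ε ∂_{tₙ} ⋯ ∂_{t₁}` given by a word `t₁ ⋯ tₙ`. -/
def wordForm : List X → FreeAlgebra K X →ₗ[K] K
  | [] => counit.toLinearMap
  | t :: l => wordForm l ∘ₗ skewDer q t

theorem wordForm_nil (v : FreeAlgebra K X) : wordForm q [] v = counit v := rfl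

theorem wordForm_cons (t : X) (l : List X) (v : FreeAlgebra K X) :
    wordForm q (t :: l) v = wordForm q l (skewDer q t v) := rfl

/-- Concatenation of words is the convolution product of their forms. This is what makes the common
kernel of the forms a coideal. -/
theorem wordForm_append (l m : List X) (v : FreeAlgebra K X) :
    TensorProduct.lid K K (TensorProduct.map (wordForm q l) (wordForm q m)
      (comul K (fun _ _ => q) v)) = wordForm q (l ++ m) v := by
  induction l generalizing v with
  | nil =>
    conv_rhs => rw [List.nil_append, ← counit_comul q v]
    induction comul K (fun _ _ => q) v using TensorProduct.induction_on with
    | zero => simp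
    | tmul a b => simp [wordForm_nil]
    | add a b ha hb => simp only [map_add, ha, hb]
  | cons t l ih =>
    rw [List.cons_append, wordForm_cons, ← ih, comul_skewDer,
      ← LinearMap.comp_apply (TensorProduct.map (wordForm q l) (wordForm q m)),
      ← TensorProduct.map_comp]
    rfl

end Derivations

/-! ### Gradings of the tensor algebra -/

section Grading

variable {K : Type*} [Field K] {X : Type*} {G : Type*} [Group G]

variable (K) in
/-- The component of degree `g` of `TV` when `e_t` has degree `c t`. -/
def gradedPart (c : X → G) (g : G) : Submodule K (FreeAlgebra K X) :=
  Submodule.span K (word K '' {l | (l.map c).prod = g})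

theorem word_mem_gradedPart (c : X → G) (l : List X) :
    word K l ∈ gradedPart K c (l.map c).prod :=
  Submodule.subset_span ⟨l, rfl, rfl⟩

theorem gradedPart_induction {c : X → G} {g : G} {P : FreeAlgebra K X → Prop}
    (hw : ∀ l : List X, (l.map c).prod = g → P (word K l)) (zero : P 0)
    (add : ∀ u v, P u → P v → P (u + v)) (smul : ∀ (r : K) v, P v → P (r • v))
    {v : FreeAlgebra K X} (hv : v ∈ gradedPart K c g) : P v := by
  induction hv using Submodule.span_induction with
  | mem x hx =>
    obtain ⟨l, hl, rfl⟩ := hx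
    exact hw l hl
  | zero => exact zero
  | add x y _ _ hx hy => exact add x y hx hy
  | smul a x _ hx => exact smul a x hx

theorem iSup_gradedPart (c : X → G) : ⨆ g, gradedPart K c g = ⊤ := by
  rw [eq_top_iff, ← span_range_word, Submodule.span_le]
  rintro _ ⟨l, rfl⟩
  exact Submodule.mem_iSup_of_mem _ (word_mem_gradedPart c l)

theorem exists_finsupp_gradedPart (c : X → G) (v : FreeAlgebra K X) :
    ∃ f : G →₀ FreeAlgebra K X, (∀ g, f g ∈ gradedPart K c g) ∧ (f.sum fun _ x => x) = v := by
  rw [← Submodule.mem_iSup_iff_exists_finsupp, iSup_gradedPart]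
  trivial

theorem ι_mul_mem_gradedPart {c : X → G} {g : G} (s : X) {v : FreeAlgebra K X}
    (hv : v ∈ gradedPart K c g) : FreeAlgebra.ι K s * v ∈ gradedPart K c (c s * g) := by
  refine gradedPart_induction (P := fun v => FreeAlgebra.ι K s * v ∈ gradedPart K c (c s * g))
    (fun l hl => ?_) (by simp) (fun u v hu hv => ?_) (fun r v hv => ?_) hv
  · exact Submodule.subset_span ⟨s :: l, by simp [← hl], rfl⟩
  · simpa only [mul_add] using add_mem hu hv
  · simpa only [mul_smul_comm] using Submodule.smul_mem _ r hv

theorem counit_eq_zero_of_mem_gradedPart {c : X → G} {g : G} (hg : g ≠ 1)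
    {v : FreeAlgebra K X} (hv : v ∈ gradedPart K c g) : counit v = 0 := by
  refine gradedPart_induction (P := fun v => counit v = 0)
    (fun l hl => counit_word l ?_) (by simp) (fun u v hu hv => ?_) (fun r v hv => ?_) hv
  · rintro rfl
    exact hg hl.symm
  · rw [map_add, hu, hv, add_zero]
  · rw [map_smul, hv, smul_zero]

theorem prod_map_ofAdd_one (l : List X) :
    (l.map fun _ => Multiplicative.ofAdd (1 : ℤ)).prod = Multiplicative.ofAdd (l.length : ℤ) := by
  simp [← ofAdd_nsmul]

theorem gradedPart_le_degreePart (n : ℤ) (hn : 0 ≤ n) :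
    gradedPart K (fun _ : X => Multiplicative.ofAdd (1 : ℤ)) (Multiplicative.ofAdd n) ≤
      degreePart K n.toNat := by
  refine Submodule.span_mono (Set.image_mono fun l hl => ?_)
  rw [Set.mem_ofPred_eq, prod_map_ofAdd_one] at hl
  have := Multiplicative.ofAdd.injective hl
  simp only [Set.mem_ofPred_eq]
  omega

theorem gradedPart_of_neg (n : ℤ) (hn : n < 0) :
    gradedPart K (fun _ : X => Multiplicative.ofAdd (1 : ℤ)) (Multiplicative.ofAdd n) = ⊥ := by
  rw [gradedPart, Submodule.span_eq_bot]
  rintro _ ⟨l, hl, rfl⟩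
  rw [Set.mem_ofPred_eq, prod_map_ofAdd_one] at hl
  have := Multiplicative.ofAdd.injective hl
  omega

theorem exists_mem_degreePart {g : Multiplicative ℤ} {v : FreeAlgebra K X}
    (hv : v ∈ gradedPart K (fun _ : X => Multiplicative.ofAdd (1 : ℤ)) g) :
    ∃ n, v ∈ degreePart K n := by
  obtain ⟨n, rfl⟩ := Multiplicative.ofAdd.surjective g
  rcases lt_or_ge n 0 with hn | hn
  · rw [gradedPart_of_neg n hn, Submodule.mem_bot] at hv
    exact ⟨0, hv ▸ zero_mem _⟩
  · exact ⟨_, gradedPart_le_degreePart n hn hv⟩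

theorem counit_eq_zero_of_degree {v : FreeAlgebra K X}
    (hv : v ∈ ⨆ n ≥ 2, degreePart (X := X) K n) : counit v = 0 := by
  have h : (⨆ n ≥ 2, degreePart (X := X) K n) ≤ LinearMap.ker counit.toLinearMap := by
    refine iSup₂_le fun n hn => Submodule.span_le.2 ?_
    rintro _ ⟨l, rfl, rfl⟩
    refine counit_word l ?_
    rintro rfl
    simp at hn
  exact h hv

theorem letterCoeff_eq_zero_of_degree [DecidableEq X] {v : FreeAlgebra K X}
    (hv : v ∈ ⨆ n ≥ 2, degreePart (X := X) K n) (t : X) : letterCoeff t v = 0 := by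
  have h : (⨆ n ≥ 2, degreePart (X := X) K n) ≤ LinearMap.ker (letterCoeff t) := by
    refine iSup₂_le fun n hn => Submodule.span_le.2 ?_
    rintro _ ⟨l, rfl, rfl⟩
    exact letterCoeff_word t l hn
  exact h hv

variable [Rack X]

/-- The family of the left translation and the degree of a letter. -/
def actDegree (t : X) : Equiv.Perm X × Multiplicative ℤ :=
  (Rack.act' t, Multiplicative.ofAdd 1)

theorem actDegree_act_mul (s t : X) :
    actDegree (s ◃ t) * actDegree s = actDegree s * actDegree t := by
  ext1
  · simp [actDegree, Rack.ad_conj]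
  · simp [actDegree]

theorem prod_map_actDegree (l : List X) :
    (l.map actDegree).prod = ((l.map Rack.act').prod, Multiplicative.ofAdd (l.length : ℤ)) := by
  induction l with
  | nil => rfl
  | cons s l ih => ext1 <;> simp [ih, actDegree, ofAdd_add, mul_comm]

variable [DecidableEq X] (q : K)

/-- The relation `hc` is exactly what gives the two terms of the twisted Leibniz rule the same
degree. -/
theorem skewDer_mem_gradedPart {c : X → G} (hc : ∀ s t, c (s ◃ t) * c s = c s * c t) {g : G}
    (t : X) {v : FreeAlgebra K X} (hv : v ∈ gradedPart K c g) :
    skewDer q t v ∈ gradedPart K c ((c t)⁻¹ * g) := by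
  have key : ∀ (l : List X) (t : X),
      skewDer q t (word K l) ∈ gradedPart K c ((c t)⁻¹ * (l.map c).prod) := by
    intro l
    induction l with
    | nil => simp [word_nil, skewDer_one]
    | cons s l ih =>
      intro t
      rw [word_cons, skewDer_ι_mul]
      refine add_mem ?_ (Submodule.smul_mem _ _ ?_)
      · split_ifs with h
        · subst h
          simpa using word_mem_gradedPart (K := K) c l
        · exact zero_mem _
      · have h := ι_mul_mem_gradedPart s (ih (s ◃⁻¹ t))
        have e : c s * (c (s ◃⁻¹ t))⁻¹ = (c t)⁻¹ * c s := by
          have := hc s (s ◃⁻¹ t)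
          rw [Rack.act_invAct_eq] at this
          rw [mul_inv_eq_iff_eq_mul, mul_assoc, ← this, inv_mul_cancel_left]
        rwa [← mul_assoc, e, mul_assoc, ← List.prod_cons, ← List.map_cons] at h
  refine gradedPart_induction (P := fun v => skewDer q t v ∈ gradedPart K c ((c t)⁻¹ * g))
    (fun l hl => ?_) (by simp) (fun u v hu hv => ?_) (fun r v hv => ?_) hv
  · rw [← hl]
    exact key l t
  · simpa only [map_add] using add_mem hu hv
  · simpa only [map_smul] using Submodule.smul_mem _ r hv

/-- Each `∂_t` strips `c t` from the left of the degree and `ε` sees only the trivial degree, so a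
word form detects a single degree. -/
theorem wordForm_eq_zero_of_mem_gradedPart {c : X → G}
    (hc : ∀ s t, c (s ◃ t) * c s = c s * c t) (l : List X) {g : G} (hg : (l.map c).prod ≠ g)
    {v : FreeAlgebra K X} (hv : v ∈ gradedPart K c g) : wordForm q l v = 0 := by
  induction l generalizing g v with
  | nil => exact counit_eq_zero_of_mem_gradedPart (Ne.symm hg) hv
  | cons t l ih =>
    refine ih (fun h => hg ?_) (skewDer_mem_gradedPart q hc t hv)
    simp [h]

theorem skewDer_word_mul (t : X) (l : List X) (x : FreeAlgebra K X) :
    skewDer q t (word K l * x) = skewDer q t (word K l) * x +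
      q ^ l.length • (word K l * skewDer q ((l.map Rack.act').prod⁻¹ t) x) := by
  induction l generalizing t with
  | nil => simp [word_nil, skewDer_one]
  | cons s l ih =>
    rw [word_cons, mul_assoc, skewDer_ι_mul, ih, skewDer_ι_mul]
    have e : (List.map Rack.act' (s :: l)).prod⁻¹ t =
        (List.map Rack.act' l).prod⁻¹ (s ◃⁻¹ t) := by
      simp [mul_inv_rev, Equiv.Perm.mul_apply, Rack.invAct_apply]
    rw [e]
    simp only [mul_add, add_mul, smul_add, smul_mul_assoc, mul_smul_comm, mul_assoc, smul_smul,
      List.length_cons, pow_succ', ← add_assoc]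
    split_ifs <;> simp

/-- The twist in the Leibniz rule depends on the left factor only through its left translation and
its length, hence the grading by `actDegree`. This serves to show that the radical is stable under
right multiplication. -/
theorem skewDer_mul_of_mem_gradedPart (t : X) {g : Equiv.Perm X × Multiplicative ℤ}
    {v : FreeAlgebra K X} (hv : v ∈ gradedPart K actDegree g) (x : FreeAlgebra K X) :
    skewDer q t (v * x) = skewDer q t v * x +
      q ^ g.2.toAdd.toNat • (v * skewDer q (g.1⁻¹ t) x) := by
  refine gradedPart_induction (P := fun v => skewDer q t (v * x) = skewDer q t v * x +
      q ^ g.2.toAdd.toNat • (v * skewDer q (g.1⁻¹ t) x))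
    (fun l hl => ?_) (by simp) (fun u v hu hv => ?_) (fun r v hv => ?_) hv
  · rw [skewDer_word_mul, ← hl, prod_map_actDegree]
    simp
  · simp only [add_mul, map_add, hu, hv, smul_add]
    abel
  · simp only [smul_mul_assoc, map_smul, hv, smul_add, smul_comm r]

end Grading

/-! ### The Nichols ideal as the radical of the word forms -/

section Radical

variable {K : Type*} [Field K] {X : Type*} [Rack X] [DecidableEq X] (q : K)

/-- The elements on which all word forms vanish. -/
def wordRadical : Submodule K (FreeAlgebra K X) := ⨅ l, LinearMap.ker (wordForm q l)

theorem mem_wordRadical {v : FreeAlgebra K X} :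
    v ∈ wordRadical q ↔ ∀ l, wordForm q l v = 0 := by
  simp [wordRadical]

theorem skewDer_mem_wordRadical (t : X) {v : FreeAlgebra K X} (hv : v ∈ wordRadical q) :
    skewDer q t v ∈ wordRadical q :=
  (mem_wordRadical q).2 fun l => (mem_wordRadical q).1 hv (t :: l)

/-- The radical is graded for every compatible degree map: a word form that is nonzero on one of the
summands vanishes on all the others, whose degrees differ. -/
theorem mem_wordRadical_of_sum {G : Type*} [Group G] {c : X → G}
    (hc : ∀ s t, c (s ◃ t) * c s = c s * c t) {ι : Type*} {γ : ι → G}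
    (hγ : Function.Injective γ) {s : Finset ι} {f : ι → FreeAlgebra K X}
    (hf : ∀ i, f i ∈ gradedPart K c (γ i)) (h : ∑ i ∈ s, f i ∈ wordRadical q) {i : ι}
    (hi : i ∈ s) : f i ∈ wordRadical q := by
  rw [mem_wordRadical] at h ⊢
  intro l
  by_cases hl : (l.map c).prod = γ i
  · have h' := h l
    rwa [map_sum, Finset.sum_eq_single_of_mem i hi] at h'
    intro j _ hj
    exact wordForm_eq_zero_of_mem_gradedPart q hc l (fun e => hj (hγ (e.symm.trans hl))) (hf j)
  · exact wordForm_eq_zero_of_mem_gradedPart q hc l hl (hf i)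

theorem ι_mul_mem_wordRadical (s : X) {v : FreeAlgebra K X} (hv : v ∈ wordRadical q) :
    FreeAlgebra.ι K s * v ∈ wordRadical q := by
  rw [mem_wordRadical]
  intro l
  induction l generalizing s v with
  | nil => simp [wordForm_nil]
  | cons t l ih =>
    rw [wordForm_cons, skewDer_ι_mul, map_add, map_smul,
      ih s (skewDer_mem_wordRadical q (s ◃⁻¹ t) hv), smul_zero, add_zero]
    split_ifs
    · exact (mem_wordRadical q).1 hv l
    · exact map_zero _

theorem mul_mem_wordRadical (a : FreeAlgebra K X) {v : FreeAlgebra K X}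
    (hv : v ∈ wordRadical q) : a * v ∈ wordRadical q := by
  induction a using freeAlgebra_induction_left with
  | one => simpa using hv
  | mul s b hb =>
    rw [mul_assoc]
    exact ι_mul_mem_wordRadical q s hb
  | add a b ha hb =>
    rw [add_mul]
    exact add_mem ha hb
  | smul r b hb =>
    rw [smul_mul_assoc]
    exact Submodule.smul_mem _ _ hb

theorem mem_wordRadical_mul {v : FreeAlgebra K X} (hv : v ∈ wordRadical q)
    (x : FreeAlgebra K X) : v * x ∈ wordRadical q := by
  have key : ∀ (l : List X) (g : Equiv.Perm X × Multiplicative ℤ) (v x : FreeAlgebra K X),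
      v ∈ gradedPart K actDegree g → v ∈ wordRadical q → wordForm q l (v * x) = 0 := by
    intro l
    induction l with
    | nil =>
      intro g v x _ hv
      have h : counit v = 0 := (mem_wordRadical q).1 hv []
      rw [wordForm_nil, map_mul, h, zero_mul]
    | cons t l ih =>
      intro g v x hg hv
      rw [wordForm_cons, skewDer_mul_of_mem_gradedPart q t hg, map_add, map_smul,
        ih _ _ _ (skewDer_mem_gradedPart q actDegree_act_mul t hg)
          (skewDer_mem_wordRadical q t hv), ih _ _ _ hg hv, smul_zero, add_zero]
  -- The Leibniz rule for `v * x` requires `v` homogeneous, and the homogeneous parts of `v` stay in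
  -- the radical.
  obtain ⟨f, hf, rfl⟩ := exists_finsupp_gradedPart actDegree v
  have hf' := @mem_wordRadical_of_sum K _ X _ _ q _ _ _ actDegree_act_mul _ _
    Function.injective_id f.support f hf hv
  rw [Finsupp.sum, Finset.sum_mul]
  refine sum_mem fun g hg => (mem_wordRadical q).2 fun l => key l g _ x (hf g) (hf' hg)

/-- The ideal on which all word forms vanish. -/
def wordIdeal : Ideal (FreeAlgebra K X) :=
  { (wordRadical q).toAddSubmonoid with
    smul_mem' := fun a _ hv => mul_mem_wordRadical q a hv }

theorem mem_wordIdeal {v : FreeAlgebra K X} :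
    v ∈ wordIdeal q ↔ ∀ l, wordForm q l v = 0 :=
  mem_wordRadical q

theorem eq_zero_of_mem_degreePart_zero {v : FreeAlgebra K X} (hv : v ∈ degreePart K 0)
    (hv' : v ∈ wordRadical q) : v = 0 := by
  have h : v = counit v • 1 := by
    clear hv'
    induction hv using Submodule.span_induction with
    | mem x hx =>
      obtain ⟨l, hl, rfl⟩ := hx
      rw [List.length_eq_zero_iff.1 hl, word_nil, map_one, one_smul]
    | zero => simp
    | add x y _ _ hx hy => rw [map_add, add_smul, ← hx, ← hy]
    | smul a x _ hx => rw [map_smul, smul_assoc, ← hx]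
  rw [h, show counit v = 0 from (mem_wordRadical q).1 hv' [], zero_smul]

theorem eq_zero_of_mem_degreePart_one [Fintype X] {v : FreeAlgebra K X}
    (hv : v ∈ degreePart K 1) (hv' : v ∈ wordRadical q) : v = 0 := by
  have h : v = ∑ t, wordForm q [t] v • FreeAlgebra.ι K t := by
    clear hv'
    induction hv using Submodule.span_induction with
    | mem x hx =>
      obtain ⟨l, hl, rfl⟩ := hx
      obtain ⟨s, rfl⟩ := List.length_eq_one_iff.1 hl
      rw [Finset.sum_eq_single s]
      · simp [wordForm_cons, word, skewDer_ι, wordForm_nil]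
      · intro t _ hts
        simp [wordForm_cons, word, skewDer_ι, hts.symm]
      · simp
    | zero => simp
    | add x y _ _ hx hy =>
      simp only [map_add, add_smul, Finset.sum_add_distrib, ← hx, ← hy]
    | smul a x _ hx => simp only [map_smul, smul_assoc, ← Finset.smul_sum, ← hx]
  rw [h]
  exact Finset.sum_eq_zero fun t _ => by rw [(mem_wordRadical q).1 hv', zero_smul]

/-- A tensor on which all products of a separating family of functionals vanish is zero. -/
theorem tensor_eq_zero_of_separating {U I : Type*} [AddCommGroup U] [Module K U]
    (φ : I → U →ₗ[K] K) (hφ : ∀ u, (∀ i, φ i u = 0) → u = 0) (z : U ⊗[K] U)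
    (hz : ∀ i j, TensorProduct.lid K K (TensorProduct.map (φ i) (φ j) z) = 0) : z = 0 := by
  have h1 : ∀ z i j, φ i (TensorProduct.rid K U (TensorProduct.map LinearMap.id (φ j) z)) =
      TensorProduct.lid K K (TensorProduct.map (φ i) (φ j) z) := by
    intro z i j
    induction z using TensorProduct.induction_on with
    | zero => simp
    | tmul a b => simp [mul_comm]
    | add a b ha hb => simp only [map_add, ha, hb]
  classical
  let b := Module.Basis.ofVectorSpace K U
  let e := TensorProduct.equivFinsuppOfBasisLeft (N := U) b
  have h2 : ∀ z j, Finsupp.mapRange.linearMap (φ j) (e z) =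
      b.repr (TensorProduct.rid K U (TensorProduct.map LinearMap.id (φ j) z)) := by
    intro z j
    induction z using TensorProduct.induction_on with
    | zero => simp
    | tmul x y =>
      ext i
      simp [e, mul_comm]
    | add a b ha hb => simp only [map_add, ha, hb]
  -- Write `z = ∑ bᵢ ⊗ uᵢ`. Applying `id ⊗ φ j` gives `∑ φ j (uᵢ) bᵢ`, which all `φ i` kill; so
  -- every `φ j (uᵢ)` is zero, hence every `uᵢ`.
  rw [← e.map_eq_zero_iff]
  ext1 i
  refine hφ _ fun j => ?_
  have h3 : TensorProduct.rid K U (TensorProduct.map LinearMap.id (φ j) z) = 0 :=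
    hφ _ fun i => (h1 z i j).trans (hz i j)
  simpa [h3] using DFunLike.congr_fun (h2 z j) i

theorem wordIdeal_coideal {x : FreeAlgebra K X} (hx : x ∈ wordIdeal q) :
    comul K (fun _ _ => q) x ∈ idealTensor K (wordIdeal q) := by
  let J := (wordIdeal q).restrictScalars K (M := FreeAlgebra K X)
  -- `J ⊗ TV + TV ⊗ J` is the kernel of `TV ⊗ TV → TV/J ⊗ TV/J`, and the word forms separate the
  -- points of `TV/J`.
  have hker := TensorProduct.map_ker (R := K) (f := J.subtype) (g := J.mkQ) (f' := J.subtype)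
    (g' := J.mkQ) (by rw [LinearMap.exact_iff]; simp) J.mkQ_surjective
    (by rw [LinearMap.exact_iff]; simp) J.mkQ_surjective
  have : comul K (fun _ _ => q) x ∈ LinearMap.ker (TensorProduct.map J.mkQ J.mkQ) := by
    rw [LinearMap.mem_ker]
    let φ : List X → (FreeAlgebra K X ⧸ J) →ₗ[K] K := fun l =>
      J.liftQ (wordForm q l) fun v hv => (mem_wordIdeal q).1 hv l
    refine tensor_eq_zero_of_separating φ ?_ _ fun l m => ?_
    · intro u hu
      obtain ⟨v, rfl⟩ := J.mkQ_surjective u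
      rw [Submodule.mkQ_apply, Submodule.Quotient.mk_eq_zero]
      exact (mem_wordIdeal q).2 hu
    · rw [← LinearMap.comp_apply (TensorProduct.map (φ l) (φ m)), ← TensorProduct.map_comp]
      have hl : ∀ l, φ l ∘ₗ J.mkQ = wordForm q l := fun l => J.liftQ_mkQ _ _
      rw [hl, hl, wordForm_append]
      exact (mem_wordIdeal q).1 hx _
  rw [hker] at this
  rw [idealTensor, sup_comm]
  exact this

theorem isNicholsCandidate_wordIdeal [Fintype X] :
    IsNicholsCandidate K (fun _ _ : X => q) (wordIdeal q) := by
  have hc : ∀ s t : X, (fun _ : X => Multiplicative.ofAdd (1 : ℤ)) (s ◃ t) *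
      (fun _ : X => Multiplicative.ofAdd (1 : ℤ)) s =
      (fun _ : X => Multiplicative.ofAdd (1 : ℤ)) s *
      (fun _ : X => Multiplicative.ofAdd (1 : ℤ)) t := fun _ _ => rfl
  refine ⟨⟨fun {a} b ha => mem_wordRadical_mul q ha b⟩, fun x hx => ?_, fun x hx => ?_,
    fun x hx => wordIdeal_coideal q hx⟩
  · obtain ⟨f, hf, rfl⟩ := exists_finsupp_gradedPart
      (fun _ : X => Multiplicative.ofAdd (1 : ℤ)) x
    have hf' := @mem_wordRadical_of_sum K _ X _ _ q _ _ _ hc _ _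
      Function.injective_id f.support f hf hx
    refine sum_mem fun g hg => ?_
    obtain ⟨n, hn⟩ := exists_mem_degreePart (hf g)
    exact Submodule.mem_iSup_of_mem n ⟨hf' hg, hn⟩
  · obtain ⟨f, hf, rfl⟩ := exists_finsupp_gradedPart
      (fun _ : X => Multiplicative.ofAdd (1 : ℤ)) x
    have hf' := @mem_wordRadical_of_sum K _ X _ _ q _ _ _ hc _ _
      Function.injective_id f.support f hf hx
    refine sum_mem fun g hg => ?_
    obtain ⟨n, hn⟩ := exists_mem_degreePart (hf g)
    -- In degrees 0 and 1 the functionals `ε` and `ε ∂_t` already determine an element, so the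
    -- radical has nothing there.
    match n, hn with
    | 0, hn => exact (eq_zero_of_mem_degreePart_zero q hn (hf' hg)).symm ▸ zero_mem _
    | 1, hn => exact (eq_zero_of_mem_degreePart_one q hn (hf' hg)).symm ▸ zero_mem _
    | n + 2, hn =>
      exact Submodule.mem_iSup_of_mem (n + 2)
        (Submodule.mem_iSup_of_mem (Nat.le_add_left 2 n) hn)

theorem IsNicholsCandidate.skewDer_mem {J : Ideal (FreeAlgebra K X)}
    (hJ : IsNicholsCandidate K (fun _ _ : X => q) J) (t : X) {v : FreeAlgebra K X} (hv : v ∈ J) :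
    skewDer q t v ∈ J := by
  -- `e_t^* ⊗ id` kills `J ⊗ TV`, since `J` lies in degrees at least 2, and sends `TV ⊗ J` into `J`.
  have h : idealTensor K J ≤ (J.restrictScalars K).comap
      ((TensorProduct.lid K (FreeAlgebra K X)).toLinearMap ∘ₗ
        TensorProduct.map (letterCoeff t) LinearMap.id) := by
    refine sup_le ?_ ?_
    · rintro _ ⟨z, rfl⟩
      induction z using TensorProduct.induction_on with
      | zero => simp
      | tmul a b =>
        have ha : letterCoeff t (a : FreeAlgebra K X) = 0 :=
          letterCoeff_eq_zero_of_degree (hJ.degree a.2) t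
        simp [ha]
      | add a b ha hb => rw [map_add]; exact add_mem ha hb
    · rintro _ ⟨z, rfl⟩
      induction z using TensorProduct.induction_on with
      | zero => simp
      | tmul a b =>
        simpa using Submodule.smul_mem (J.restrictScalars K) _ b.2
      | add a b ha hb => rw [map_add]; exact add_mem ha hb
  exact h (hJ.coideal v hv)

/-- The Nichols ideal consists of the elements on which all word forms vanish. -/
theorem mem_nicholsIdeal [Fintype X] {v : FreeAlgebra K X} :
    v ∈ nicholsIdeal K (fun _ _ : X => q) ↔ ∀ l, wordForm q l v = 0 := by
  have hI := nicholsIdeal_isGreatest (X := X) K (fun _ _ => q)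
  constructor
  · intro hv l
    induction l generalizing v with
    | nil => exact counit_eq_zero_of_degree (hI.1.degree hv)
    | cons t l ih => exact ih (hI.1.skewDer_mem q t hv)
  · intro hv
    exact hI.2 (isNicholsCandidate_wordIdeal q) ((mem_wordIdeal q).2 hv)

end Radical

instance : Fintype Tetra := inferInstanceAs (Fintype (Fin 4))

instance : DecidableEq Tetra := inferInstanceAs (DecidableEq (Fin 4))

/-! ### An integral model of the Nichols algebra of the tetrahedral quandle

The model has a basis of 72 monomials, numbered from 0. A pair `(P, N)` of lists of indices stands
for the sum of the basis vectors in `P` minus the sum of those in `N`. -/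

/-- The products of the letters with the basis monomials. -/
def leftTable : Tetra → List (List ℕ × List ℕ) :=
  ![
    [
      ([1], []), ([], []), ([5], []), ([6], []), ([7], []), ([], []), ([], []), ([], []),
      ([13], []), ([14], []), ([15], []), ([16], []), ([17], []), ([], []), ([], []), ([], []),
      ([], []), ([], []), ([24], []), ([25], []), ([26], []), ([27], []), ([28], []), ([29], []),
      ([], []), ([], []), ([], []), ([], []), ([], []), ([], []), ([36], []), ([37], []),
      ([38], []), ([39], []), ([40], []), ([41], []), ([], []), ([], []), ([], []), ([], []),
      ([], []), ([], []), ([48], []), ([49], []), ([50], []), ([51], []), ([52], []), ([53], []),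
      ([], []), ([], []), ([], []), ([], []), ([], []), ([], []), ([59], []), ([60], []),
      ([61], []), ([62], []), ([63], []), ([], []), ([], []), ([], []), ([], []), ([], []),
      ([67], []), ([68], []), ([69], []), ([], []), ([], []), ([], []), ([71], []), ([], [])],
    [
      ([2], []), ([8], []), ([], []), ([9], []), ([10], []), ([13], []), ([18], []), ([19], []),
      ([], []), ([], []), ([], []), ([20], []), ([21], []), ([], []), ([24], []), ([25], []),
      ([30], []), ([31], []), ([], []), ([], []), ([], []), ([], []), ([32], []), ([33], []),
      ([], []), ([], []), ([36], []), ([37], []), ([42], []), ([43], []), ([], []), ([], []),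
      ([], []), ([], []), ([44], []), ([45], []), ([], []), ([], []), ([48], []), ([49], []),
      ([54], []), ([55], []), ([], []), ([], []), ([], []), ([], []), ([56], []), ([57], []),
      ([], []), ([], []), ([59], []), ([60], []), ([64], []), ([65], []), ([], []), ([], []),
      ([], []), ([], []), ([66], []), ([], []), ([], []), ([67], []), ([68], []), ([70], []),
      ([], []), ([], []), ([], []), ([], []), ([], []), ([71], []), ([], []), ([], [])],
    [
      ([3], []), ([], [5, 9]), ([11], []), ([], []), ([12], []), ([], [20]), ([], [14]),
      ([], [15, 21]), ([22], []), ([20], []), ([23], []), ([], []), ([], []), ([], [32]), ([], []),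
      ([], [33]), ([], [26]), ([], [27]), ([34], []), ([35], []), ([], []), ([33], []), ([], []),
      ([], []), ([], [44]), ([], [45]), ([], []), ([], []), ([], [38]), ([], [39]), ([46], []),
      ([47], []), ([], []), ([], []), ([], []), ([], []), ([], [56]), ([], [57]), ([], []),
      ([], []), ([], [50]), ([], [51]), ([], [52, 54]), ([58], []), ([], []), ([], []), ([], []),
      ([], []), ([64], []), ([], [66]), ([], []), ([], []), ([], [61]), ([], [62]), ([61], []),
      ([], [63, 65]), ([], []), ([], []), ([], []), ([], [67]), ([70], []), ([], []), ([], []),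
      ([], [69]), ([], []), ([69], []), ([], []), ([], []), ([], [71]), ([], []), ([], []), ([], [])],
    [
      ([4], []), ([], [6, 12]), ([], [7, 8]), ([], [10, 11]), ([], []), ([22], [15, 16, 21]),
      ([23], []), ([], [17]), ([17], []), ([15, 16], [18]), ([], [19]), ([19], []), ([], [23]),
      ([27], [28]), ([33, 34], []), ([35], [29]), ([], [35]), ([], []), ([], [29]), ([], []),
      ([], [25, 30]), ([29], [31]), ([], [31]), ([], []), ([], [39, 40]), ([], [41]), ([46], [45]),
      ([47], []), ([47], []), ([], []), ([41], []), ([], []), ([37], [42]), ([], [43]), ([43], []),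
      ([], []), ([51], [52]), ([], [53]), ([57], [52, 54]), ([58], []), ([], [58]), ([], []),
      ([], [53]), ([], []), ([], [49, 54]), ([], [55]), ([], [55]), ([], []), ([59], [62]),
      ([], [63]), ([61], [66]), ([], [63, 65]), ([], [63, 65]), ([], []), ([63], []), ([], []),
      ([60], [64]), ([], [65]), ([], []), ([69], []), ([68], []), ([], [70]), ([69], []), ([], []),
      ([68], []), ([], []), ([], [70]), ([71], []), ([], []), ([], []), ([], []), ([], [])]]

/-- The skew derivatives of the basis monomials. -/
def derTable : Tetra → List (List ℕ × List ℕ) :=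
  ![
    [
      ([], []), ([0], []), ([], []), ([], []), ([], []), ([2], []), ([3], []), ([4], []), ([], []),
      ([], [2]), ([], []), ([], []), ([], [3]), ([8], []), ([5, 9], []), ([10], []), ([11], []),
      ([6, 12], []), ([], []), ([], []), ([], []), ([], [10]), ([11], []), ([], []), ([18], []),
      ([19], []), ([20], []), ([15, 21], []), ([22], [16]), ([23], []), ([], []), ([], []),
      ([], []), ([], [20]), ([20], []), ([23], []), ([30], []), ([31], []), ([32], []),
      ([26, 33], []), ([34], [26]), ([35], [29]), ([], []), ([], []), ([32], []), ([], []),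
      ([], []), ([33, 34], []), ([42], []), ([43], []), ([44], [38]), ([45], []), ([46], []),
      ([47], [39, 40]), ([], []), ([], []), ([], []), ([45], []), ([], []), ([54], []), ([55], []),
      ([56], []), ([57], [51]), ([58], []), ([], []), ([], []), ([56], []), ([64], []), ([65], []),
      ([66], [61]), ([], []), ([70], [])],
    [
      ([], []), ([], []), ([0], []), ([], []), ([], []), ([], []), ([], []), ([], [1]), ([1], []),
      ([3], []), ([4], []), ([], []), ([], []), ([5], []), ([], []), ([], []), ([6], []), ([], []),
      ([6], []), ([7, 8], []), ([11], []), ([12], []), ([], []), ([], []), ([14], []), ([15], []),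
      ([], []), ([], [14]), ([], [14]), ([17], []), ([16], [18]), ([17], []), ([22], []),
      ([23], []), ([], []), ([], []), ([26], []), ([24, 27], []), ([26], []), ([], []), ([], []),
      ([28], [27]), ([24, 28], []), ([29], [31]), ([34], []), ([35], []), ([], []), ([], []),
      ([38], [36]), ([39], []), ([], []), ([39], []), ([], [40]), ([], []), ([40], []),
      ([37, 41], [42]), ([46], []), ([47], []), ([], []), ([50], []), ([51], [49]), ([], []),
      ([50], []), ([], [53]), ([52, 54], []), ([53], []), ([58], []), ([61], []), ([62], [59]),
      ([], []), ([63, 65], []), ([69], [])],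
    [
      ([], []), ([], []), ([], []), ([0], []), ([], []), ([], [1]), ([], []), ([], []), ([], []),
      ([], []), ([], [2]), ([2], []), ([4], []), ([], []), ([], [6]), ([], [7]), ([], []), ([], []),
      ([8], []), ([], []), ([9], []), ([], []), ([8], []), ([10, 11], []), ([], []), ([], [13]),
      ([], [16]), ([], [17]), ([], []), ([], []), ([13], []), ([19], []), ([], [13]), ([21], []),
      ([18], [22]), ([19], []), ([24], []), ([], []), ([], [28]), ([], [29]), ([], []), ([], []),
      ([], []), ([25, 30], []), ([], [24]), ([32], [25]), ([30, 32], []), ([31], [35]), ([], []),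
      ([37], []), ([], [40]), ([], [41]), ([], []), ([], []), ([], [42]), ([], []), ([], [36, 44]),
      ([], [37]), ([43, 45], [46]), ([], []), ([48], []), ([], [52]), ([], [53]), ([], []),
      ([48], []), ([], [55]), ([], [49, 57]), ([], [59]), ([], []), ([], [63]), ([60], [64]),
      ([], [68])],
    [
      ([], []), ([], []), ([], []), ([], []), ([0], []), ([], []), ([], [1]), ([], []), ([], [2]),
      ([], []), ([], []), ([], [3]), ([], []), ([], []), ([], []), ([5], []), ([], [5]), ([], [7]),
      ([], [9]), ([], [10]), ([], []), ([9], []), ([5, 9], []), ([], [12]), ([], [13]), ([], []),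
      ([], [14]), ([], []), ([], [13]), ([], [15, 16]), ([], [20]), ([], [18, 21]), ([], [20]),
      ([], []), ([14], []), ([15, 21], [22]), ([], []), ([], [25]), ([], []), ([], [27]),
      ([28], [24]), ([], [25]), ([30], [32]), ([], [33]), ([], []), ([], [33]), ([26, 34], []),
      ([27], []), ([], []), ([], [36]), ([], []), ([], [38]), ([], [36, 38]), ([41], [37]),
      ([36], [44]), ([43], [45]), ([], []), ([], [44]), ([39, 47], []), ([48], []), ([], []),
      ([50], []), ([], []), ([52], [49, 51]), ([], [56]), ([49, 54], [57]), ([], []), ([], []),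
      ([60], []), ([62], []), ([], [66]), ([67], [])]]

/-- The images of `0` and `1` under the permutation that is the degree of a basis monomial. -/
def degreeTable : List (Fin 4 × Fin 4) := [
  (0, 1), (0, 2), (3, 1), (1, 3), (2, 0), (1, 2), (2, 1), (3, 0), (3, 0), (1, 2), (0, 3), (0, 3),
  (2, 1), (1, 0), (2, 3), (0, 1), (0, 1), (3, 2), (0, 1), (2, 3), (3, 2), (0, 1), (0, 1), (1, 0),
  (0, 2), (3, 1), (1, 3), (0, 2), (0, 2), (2, 0), (3, 1), (2, 0), (3, 1), (1, 3), (1, 3), (2, 0),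
  (1, 2), (3, 0), (1, 2), (2, 1), (2, 1), (3, 0), (3, 0), (0, 3), (1, 2), (0, 3), (0, 3), (2, 1),
  (1, 0), (0, 1), (2, 3), (0, 1), (0, 1), (3, 2), (0, 1), (2, 3), (3, 2), (0, 1), (1, 0), (0, 2),
  (3, 1), (1, 3), (0, 2), (2, 0), (3, 1), (2, 0), (1, 3), (1, 2), (3, 0), (2, 1), (0, 3), (0, 1)]

/-- The linear combination of pairs of lists given by a table. -/
def tableApply (T : List (List ℕ × List ℕ)) (v : List ℕ × List ℕ) : List ℕ × List ℕ :=
  (v.1.flatMap (fun i => (T.getD i ([], [])).1) ++ v.2.flatMap fun i => (T.getD i ([], [])).2,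
    v.1.flatMap (fun i => (T.getD i ([], [])).2) ++ v.2.flatMap fun i => (T.getD i ([], [])).1)

/-- The twisted Leibniz rule for `q = -1` on basis vectors. With negative terms moved across, it
becomes an equality of multisets of indices, decidable without a field and valid over every `K`. -/
theorem derTable_leftTable : ∀ s t : Tetra, ∀ i < 72,
    ((tableApply (derTable t) ((leftTable s).getD i ([], []))).1 ++
        (tableApply (leftTable s) ((derTable (s ◃⁻¹ t)).getD i ([], []))).1).Perm
      ((if s = t then [i] else []) ++
        ((tableApply (derTable t) ((leftTable s).getD i ([], []))).2 ++
          (tableApply (leftTable s) ((derTable (s ◃⁻¹ t)).getD i ([], []))).2)) := by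
  decide +kernel

theorem derTable_zero : ∀ t, (derTable t).getD 0 ([], []) = ([], []) := by
  decide +kernel

/-- The degree of a basis monomial. -/
def basisDegree (i : ℕ) : Fin 4 × Fin 4 := degreeTable.getD i (0, 0)

/-- Besides the degrees, the bounds on `j` matter: `j < 72` keeps the range of the table stable, and
`0 < j` makes coordinate 0 of the model the counit. -/
theorem leftTable_degree : ∀ s : Tetra, ∀ i < 72,
    (∀ j ∈ ((leftTable s).getD i ([], [])).1,
      (0 < j ∧ j < 72) ∧ basisDegree j =
        (tetraAct s (basisDegree i).1, tetraAct s (basisDegree i).2)) ∧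
    (∀ j ∈ ((leftTable s).getD i ([], [])).2,
      (0 < j ∧ j < 72) ∧ basisDegree j =
        (tetraAct s (basisDegree i).1, tetraAct s (basisDegree i).2)) := by
  decide +kernel

/-- The pair `(1, 0)` belongs to the double transposition `(0 1)(2 3)`. -/
theorem card_basisDegree :
    ((Finset.range 72).filter fun i => basisDegree i = (1, 0)).card = 4 := by
  decide +kernel

/-! ### The linear maps of the model -/

section Model

variable {K : Type*} [Field K]

variable (K) in
/-- The vector given by a pair of lists. -/
def listVec (v : List ℕ × List ℕ) : ℕ →₀ K :=
  (v.1.map fun i => Finsupp.single i 1).sum - (v.2.map fun i => Finsupp.single i 1).sum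

variable (K) in
/-- The linear map given by a table. -/
def tableMap (T : List (List ℕ × List ℕ)) : (ℕ →₀ K) →ₗ[K] ℕ →₀ K :=
  Finsupp.linearCombination K fun i => listVec K (T.getD i ([], []))

theorem tableMap_single (T : List (List ℕ × List ℕ)) (i : ℕ) :
    tableMap K T (Finsupp.single i 1) = listVec K (T.getD i ([], [])) := by
  simp [tableMap]

theorem tableMap_listVec (T : List (List ℕ × List ℕ)) (v : List ℕ × List ℕ) :
    tableMap K T (listVec K v) = listVec K (tableApply T v) := by
  have h : ∀ l : List ℕ, tableMap K T (l.map fun i => Finsupp.single i 1).sum =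
      ((l.flatMap fun i => (T.getD i ([], [])).1).map fun i => Finsupp.single i 1).sum -
      ((l.flatMap fun i => (T.getD i ([], [])).2).map fun i => Finsupp.single i 1).sum := by
    intro l
    induction l with
    | nil => simp
    | cons i l ih =>
      rw [List.map_cons, List.sum_cons, map_add, ih, tableMap_single, listVec]
      simp only [List.flatMap_cons, List.map_append, List.sum_append]
      abel
  rw [listVec, map_sub, h, h, listVec, tableApply]
  simp only [List.map_append, List.sum_append]
  abel

theorem tableMap_derTable_leftTable (s t : Tetra) {i : ℕ} (hi : i < 72) :
    tableMap K (derTable t) (tableMap K (leftTable s) (Finsupp.single i 1)) =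
      (if s = t then Finsupp.single i 1 else 0) -
        tableMap K (leftTable s) (tableMap K (derTable (s ◃⁻¹ t)) (Finsupp.single i 1)) := by
  have h := ((derTable_leftTable s t i hi).map fun i => Finsupp.single i (1 : K)).sum_eq
  rw [tableMap_single, tableMap_single, tableMap_listVec, tableMap_listVec, listVec, listVec]
  simp only [List.map_append, List.sum_append] at h
  have h' : ((if s = t then [i] else []).map fun i => Finsupp.single i (1 : K)).sum =
      if s = t then Finsupp.single i 1 else 0 := by
    split_ifs <;> simp
  rw [h'] at h
  rw [sub_eq_iff_eq_add, eq_sub_iff_add_eq.2 h]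
  abel

theorem listVec_mem_supported {S : Set ℕ} {v : List ℕ × List ℕ} (h1 : ∀ j ∈ v.1, j ∈ S)
    (h2 : ∀ j ∈ v.2, j ∈ S) : listVec K v ∈ Finsupp.supported K K S := by
  refine sub_mem (list_sum_mem ?_) (list_sum_mem ?_)
  · simpa using fun j hj => Finsupp.single_mem_supported K (1 : K) (h1 j hj)
  · simpa using fun j hj => Finsupp.single_mem_supported K (1 : K) (h2 j hj)

variable (K) in
/-- The action of `TV` on the model. -/
def modelHom : FreeAlgebra K Tetra →ₐ[K] Module.End K (ℕ →₀ K) :=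
  FreeAlgebra.lift K fun s => tableMap K (leftTable s)

variable (K) in
/-- The map from `TV` to the model. -/
def toModel : FreeAlgebra K Tetra →ₗ[K] ℕ →₀ K :=
  LinearMap.applyₗ (Finsupp.single 0 1) ∘ₗ (modelHom K).toLinearMap

theorem toModel_one : toModel K 1 = Finsupp.single 0 1 := by
  simp [toModel]

theorem toModel_ι_mul (s : Tetra) (v : FreeAlgebra K Tetra) :
    toModel K (FreeAlgebra.ι K s * v) = tableMap K (leftTable s) (toModel K v) := by
  simp [toModel, modelHom]

theorem supported_induction {S : Set ℕ} {P : (ℕ →₀ K) → Prop}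
    (hw : ∀ i ∈ S, P (Finsupp.single i 1)) (zero : P 0)
    (add : ∀ u v, P u → P v → P (u + v)) (smul : ∀ (r : K) v, P v → P (r • v))
    {v : ℕ →₀ K} (hv : v ∈ Finsupp.supported K K S) : P v := by
  rw [Finsupp.supported_eq_span_single] at hv
  induction hv using Submodule.span_induction with
  | mem x hx =>
    obtain ⟨i, hi, rfl⟩ := hx
    exact hw i hi
  | zero => exact zero
  | add x y _ _ hx hy => exact add x y hx hy
  | smul a x _ hx => exact smul a x hx

theorem tableMap_leftTable_mem (s : Tetra) {d : Fin 4 × Fin 4} {m : ℕ →₀ K}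
    (hm : m ∈ Finsupp.supported K K {i | i < 72 ∧ basisDegree i = d}) :
    tableMap K (leftTable s) m ∈ Finsupp.supported K K
      {i | (0 < i ∧ i < 72) ∧ basisDegree i = (tetraAct s d.1, tetraAct s d.2)} := by
  refine supported_induction (P := fun m => tableMap K (leftTable s) m ∈ Finsupp.supported K K
      {i | (0 < i ∧ i < 72) ∧ basisDegree i = (tetraAct s d.1, tetraAct s d.2)})
    (fun i hi => ?_) (by simp) (fun u v hu hv => ?_) (fun r v hv => ?_) hm
  · obtain ⟨hi, rfl⟩ := hi
    rw [tableMap_single]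
    exact listVec_mem_supported (leftTable_degree s i hi).1 (leftTable_degree s i hi).2
  · rw [map_add]
    exact add_mem hu hv
  · rw [map_smul]
    exact Submodule.smul_mem _ r hv

theorem toModel_word_mem (l : List Tetra) :
    toModel K (word K l) ∈ Finsupp.supported K K {i | i < 72 ∧ basisDegree i =
      ((l.map Rack.act').prod (0 : Fin 4), (l.map Rack.act').prod (1 : Fin 4))} := by
  induction l with
  | nil =>
    rw [word_nil, toModel_one]
    have h : (0 : ℕ) ∈ {i | i < 72 ∧ basisDegree i = ((0 : Fin 4), (1 : Fin 4))} :=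
      ⟨by norm_num, rfl⟩
    exact Finsupp.single_mem_supported K 1 h
  | cons s l ih =>
    rw [word_cons, toModel_ι_mul]
    refine Finsupp.supported_mono ?_ (tableMap_leftTable_mem s ih)
    rintro i ⟨hi, hi'⟩
    exact ⟨hi.2, hi'⟩

theorem toModel_mem (v : FreeAlgebra K Tetra) :
    toModel K v ∈ Finsupp.supported K K {i | i < 72} := by
  have h : v ∈ Submodule.span K (Set.range (word K : List Tetra → _)) := by
    rw [span_range_word]
    trivial
  induction h using Submodule.span_induction with
  | mem x hx =>
    obtain ⟨l, rfl⟩ := hx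
    exact Finsupp.supported_mono (fun i hi => hi.1) (toModel_word_mem l)
  | zero => simp
  | add x y _ _ hx hy => rw [map_add]; exact add_mem hx hy
  | smul a x _ hx => rw [map_smul]; exact Submodule.smul_mem _ _ hx

theorem toModel_skewDer (t : Tetra) (v : FreeAlgebra K Tetra) :
    toModel K (skewDer (-1) t v) = tableMap K (derTable t) (toModel K v) := by
  induction v using freeAlgebra_induction_left generalizing t with
  | one =>
    rw [skewDer_one, toModel_one, tableMap_single, derTable_zero]
    simp [listVec]
  | mul s v hv =>
    have h : ∀ m ∈ Finsupp.supported K K {i | i < 72},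
        tableMap K (derTable t) (tableMap K (leftTable s) m) =
          (if s = t then m else 0) -
            tableMap K (leftTable s) (tableMap K (derTable (s ◃⁻¹ t)) m) := by
      intro m hm
      refine supported_induction (P := fun m =>
        tableMap K (derTable t) (tableMap K (leftTable s) m) = (if s = t then m else 0) -
            tableMap K (leftTable s) (tableMap K (derTable (s ◃⁻¹ t)) m))
        (fun i hi => tableMap_derTable_leftTable s t hi) (by simp) (fun u v hu hv => ?_)
        (fun r v hv => ?_) hm
      · simp only [map_add, hu, hv]
        split_ifs <;> abel
      · simp only [map_smul, hv, smul_sub]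
        split_ifs <;> simp
    rw [skewDer_ι_mul, toModel_ι_mul, h _ (toModel_mem v), map_add, map_smul, toModel_ι_mul, hv,
      neg_one_smul, ← sub_eq_add_neg]
    split_ifs <;> simp
  | add u v hu hv => simp only [map_add, hu, hv]
  | smul r v hv => simp only [map_smul, hv]

theorem toModel_apply_zero (v : FreeAlgebra K Tetra) : toModel K v 0 = counit v := by
  have h : v ∈ Submodule.span K (Set.range (word K : List Tetra → _)) := by
    rw [span_range_word]
    trivial
  induction h using Submodule.span_induction with
  | mem x hx =>
    obtain ⟨l, rfl⟩ := hx
    cases l with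
    | nil => simp [word_nil, toModel_one]
    | cons s l =>
      have := tableMap_leftTable_mem s (toModel_word_mem (K := K) l)
      rw [counit_word _ (List.cons_ne_nil s l), word_cons, toModel_ι_mul,
        (Finsupp.mem_supported' K _).1 this]
      simp
  | zero => simp
  | add x y _ _ hx hy => simp [hx, hy]
  | smul a x _ hx => simp [hx]

/-- The model carries `∂_t` and `ε`, so every word form factors through it. Neither faithfulness nor
minimality of the model is needed. -/
theorem wordForm_eq_zero_of_toModel (l : List Tetra) {v : FreeAlgebra K Tetra}
    (hv : toModel K v = 0) : wordForm (-1) l v = 0 := by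
  induction l generalizing v with
  | nil => rw [wordForm_nil, ← toModel_apply_zero, hv, Finsupp.zero_apply]
  | cons t l ih =>
    refine ih ?_
    rw [toModel_skewDer, hv, map_zero]

end Model

/-! ### Components of the Nichols algebra -/

section Components

variable (K : Type*) [Field K] {X : Type*} [Rack X] (q : K)

/-- The quotient map from `TV` to the Nichols algebra. -/
def nicholsMk : FreeAlgebra K X →ₗ[K] NicholsAlgebra K (fun _ _ : X => q) where
  toFun := Ideal.Quotient.mk (nicholsIdeal K fun _ _ : X => q)
  map_add' _ _ := rfl
  map_smul' _ _ := rfl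

theorem nicholsMk_eq_zero [Fintype X] [DecidableEq X] {v : FreeAlgebra K X} :
    nicholsMk K q v = 0 ↔ v ∈ wordRadical q := by
  rw [mem_wordRadical, ← mem_nicholsIdeal]
  exact Ideal.Quotient.eq_zero_iff_mem

theorem map_prod_envGen {G : Type*} [Group G] (π : Rack.EnvelGroup X →* G) (l : List X) :
    π (l.map envGen).prod = (l.map fun t => π (envGen t)).prod := by
  rw [map_list_prod, List.map_map]
  rfl

theorem component_eq_map {G : Type*} [Group G] (π : Rack.EnvelGroup X →* G) (g : G) :
    component K (fun _ _ : X => q) π g =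
      (gradedPart K (fun t => π (envGen t)) g).map (nicholsMk K q) := by
  rw [gradedPart, Submodule.map_span, ← Set.image_comp]
  refine le_antisymm (iSup_le fun x => Submodule.span_mono ?_) (Submodule.span_le.2 ?_)
  · rintro _ ⟨l, hl, rfl⟩
    refine ⟨l, ?_, rfl⟩
    rw [Set.mem_ofPred_eq] at hl ⊢
    rw [← map_prod_envGen, hl, x.2]
  · rintro _ ⟨l, hl, rfl⟩
    rw [Set.mem_ofPred_eq, ← map_prod_envGen] at hl
    exact Submodule.mem_iSup_of_mem ⟨(l.map envGen).prod, hl⟩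
      (Submodule.subset_span ⟨l, rfl, rfl⟩)

theorem map_envGen_act_mul {G : Type*} [Group G] (π : Rack.EnvelGroup X →* G) (s t : X) :
    π (envGen (s ◃ t)) * π (envGen s) = π (envGen s) * π (envGen t) := by
  have h : envGen (s ◃ t) = envGen s * envGen t * (envGen s)⁻¹ :=
    (Rack.toEnvelGroup X).map_act
  rw [← map_mul, ← map_mul, h, inv_mul_cancel_right]

/-- The sum map of a finite family of components. -/
def componentSum {G : Type*} [Group G] (π : Rack.EnvelGroup X →* G) {ι : Type*} [Fintype ι]
    (γ : ι → G) : (∀ i, component K (fun _ _ : X => q) π (γ i)) →ₗ[K]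
      NicholsAlgebra K fun _ _ : X => q :=
  ∑ i, (component K (fun _ _ : X => q) π (γ i)).subtype ∘ₗ LinearMap.proj i

theorem componentSum_apply {G : Type*} [Group G] (π : Rack.EnvelGroup X →* G) {ι : Type*}
    [Fintype ι] (γ : ι → G) (x : ∀ i, component K (fun _ _ : X => q) π (γ i)) :
    componentSum K q π γ x = ∑ i, (x i : NicholsAlgebra K fun _ _ : X => q) := by
  simp [componentSum]

/-- The sum of distinct components is direct because the Nichols ideal, being the radical, is
graded: a relation lifts to homogeneous elements of `TV`. -/
theorem componentSum_injective [Fintype X] [DecidableEq X] {G : Type*} [Group G]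
    (π : Rack.EnvelGroup X →* G) {ι : Type*} [Fintype ι] {γ : ι → G}
    (hγ : Function.Injective γ) :
    Function.Injective (componentSum K q π γ) := by
  rw [← LinearMap.ker_eq_bot, LinearMap.ker_eq_bot']
  intro x hx
  rw [componentSum_apply] at hx
  have hl : ∀ i, ∃ v ∈ gradedPart K (fun t => π (envGen t)) (γ i), nicholsMk K q v = x i := by
    exact fun i => (component_eq_map K q π (γ i)).le (x i).2
  choose f hf hfx using hl
  have h : ∑ i, f i ∈ wordRadical q := by
    rw [← nicholsMk_eq_zero, map_sum]
    simpa only [hfx] using hx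
  ext i
  rw [← hfx, Pi.zero_apply, ZeroMemClass.coe_zero, nicholsMk_eq_zero]
  exact mem_wordRadical_of_sum q (map_envGen_act_mul π) hγ hf h (Finset.mem_univ i)

/-- Without surjectivity of `f`, the factorization is defined on the range through a section and
then extended to `M`. -/
theorem exists_comp_eq_of_ker_le {V M U : Type*} [AddCommGroup V] [Module K V]
    [AddCommGroup M] [Module K M] [AddCommGroup U] [Module K U] (f : V →ₗ[K] M) (h : V →ₗ[K] U)
    (hk : LinearMap.ker f ≤ LinearMap.ker h) : ∃ g : M →ₗ[K] U, g ∘ₗ f = h := by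
  obtain ⟨r, hr⟩ := f.rangeRestrict.exists_rightInverse_of_surjective f.range_rangeRestrict
  obtain ⟨g, hg⟩ := LinearMap.exists_extend (h ∘ₗ r)
  refine ⟨g, LinearMap.ext fun v => ?_⟩
  have h1 : g (f v) = h (r (f.rangeRestrict v)) := LinearMap.congr_fun hg (f.rangeRestrict v)
  have h2 : f (r (f.rangeRestrict v)) = f v :=
    congrArg Subtype.val (LinearMap.congr_fun hr (f.rangeRestrict v))
  rw [LinearMap.comp_apply, h1, ← sub_eq_zero, ← map_sub]
  refine hk ?_
  rw [LinearMap.mem_ker, map_sub, h2, sub_self]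

end Components

/-! ### Bounds for the components of the tetrahedral Nichols algebra -/

section Bounds

variable (K : Type*) [Field K]

/-- The projection to `𝔅` factors through the model, so this component is the image of a space
spanned by the four basis vectors of degree `(1, 0)`. -/
theorem finrank_le_four {p : Equiv.Perm Tetra} (h0 : p (0 : Fin 4) = (1 : Fin 4))
    (h1 : p (1 : Fin 4) = (0 : Fin 4)) :
    FiniteDimensional K ((gradedPart K Rack.act' p).map (nicholsMk K (-1))) ∧
      Module.finrank K ((gradedPart K Rack.act' p).map (nicholsMk K (-1))) ≤ 4 := by
  obtain ⟨g, hg⟩ := exists_comp_eq_of_ker_le K (toModel K) (nicholsMk (X := Tetra) K (-1))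
    fun v hv => by
      rw [LinearMap.mem_ker, nicholsMk_eq_zero, mem_wordRadical]
      exact fun l => wordForm_eq_zero_of_toModel l hv
  classical
  let S : Finset (ℕ →₀ K) := ((Finset.range 72).filter fun i => basisDegree i = (1, 0)).image
    fun i => Finsupp.single i 1
  have hS : (gradedPart K Rack.act' p).map (toModel K) ≤ Submodule.span K S := by
    rw [Submodule.map_le_iff_le_comap]
    refine Submodule.span_le.2 ?_
    rintro _ ⟨l, hl, rfl⟩
    have h := toModel_word_mem (K := K) l
    rw [Set.mem_ofPred_eq] at hl
    rw [hl, h0, h1, Finsupp.supported_eq_span_single] at h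
    refine Submodule.span_mono ?_ h
    rintro _ ⟨i, hi, rfl⟩
    obtain ⟨hi, hi'⟩ := hi
    exact Finset.mem_coe.2 (Finset.mem_image_of_mem _ (Finset.mem_filter.2
      ⟨Finset.mem_range.2 hi, hi'⟩))
  have hle : (gradedPart K Rack.act' p).map (nicholsMk K (-1)) ≤
      (Submodule.span K (S : Set (ℕ →₀ K))).map g := by
    rw [← hg, Submodule.map_comp]
    exact Submodule.map_mono hS
  have hfin : FiniteDimensional K (Submodule.span K (S : Set (ℕ →₀ K))) :=
    FiniteDimensional.span_finset K S
  refine ⟨Submodule.finiteDimensional_of_le hle, (Submodule.finrank_mono hle).trans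
    ((Submodule.finrank_map_le g _).trans ((finrank_span_finset_le_card S).trans ?_))⟩
  exact Finset.card_image_le.trans card_basisDegree.le

/-! ### Lower bound in the trivial degree. -/

variable {K}

/-- The terms of the skew derivative of a word, for the cocycle `-1`. -/
def wordDer {X : Type*} [Rack X] [DecidableEq X] (t : X) : List X → List (ℤ × List X)
  | [] => []
  | s :: l => (if s = t then [(1, l)] else []) ++
      (wordDer (s ◃⁻¹ t) l).map fun p => (-p.1, s :: p.2)

/-- The values of the word forms on words, for the cocycle `-1`. -/
def wordPairing {X : Type*} [Rack X] [DecidableEq X] : List X → List X → ℤ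
  | [], l => if l = [] then 1 else 0
  | t :: w, l => ((wordDer t l).map fun p => p.1 * wordPairing w p.2).sum

theorem skewDer_word {X : Type*} [Rack X] [DecidableEq X] (t : X) (l : List X) :
    skewDer (-1) t (word K l) = ((wordDer t l).map fun p => (p.1 : K) • word K p.2).sum := by
  induction l generalizing t with
  | nil => simp [word_nil, skewDer_one, wordDer]
  | cons s l ih =>
    rw [word_cons, skewDer_ι_mul, ih, wordDer, List.map_append, List.sum_append, List.map_map]
    congr 1
    · split_ifs <;> simp
    · induction wordDer (s ◃⁻¹ t) l with
      | nil => simp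
      | cons p m ihm =>
        rw [List.map_cons, List.sum_cons, List.map_cons, List.sum_cons, ← ihm, mul_add, smul_add]
        simp [word_cons]

theorem wordForm_word {X : Type*} [Rack X] [DecidableEq X] (w l : List X) :
    wordForm (-1) w (word K l) = (wordPairing w l : K) := by
  induction w generalizing l with
  | nil =>
    rw [wordForm_nil, wordPairing]
    split_ifs with h
    · simp [h, word_nil]
    · simp [counit_word l h]
  | cons t w ih =>
    rw [wordForm_cons, skewDer_word, wordPairing]
    induction wordDer t l with
    | nil => simp
    | cons p m ihm => simp [ihm, ih]

/-- Words of trivial degree whose images in the Nichols algebra are linearly independent. -/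
def indepWord : Fin 5 → List Tetra :=
  (![[], [0, 1, 3], [0, 2, 1], [1, 0, 2], [1, 2, 3]] : Fin 5 → List (Fin 4))

/-- Words whose forms are dual to `indepWord` up to sign. -/
def dualWord : Fin 5 → List Tetra :=
  (![[], [2, 0, 3], [0, 3, 2], [2, 3, 1], [1, 2, 3]] : Fin 5 → List (Fin 4))

theorem prod_indepWord : ∀ i, ((indepWord i).map Rack.act').prod = 1 := by
  have h : ∀ i, ∀ x : Tetra, (indepWord i).foldr (fun s y => s ◃ y) x = x := by decide +kernel
  intro i
  ext x
  have h' : ∀ l : List Tetra, (l.map Rack.act').prod x = l.foldr (fun s y => s ◃ y) x := by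
    intro l
    induction l with
    | nil => rfl
    | cons s l ih =>
      rw [List.map_cons, List.prod_cons, Equiv.Perm.mul_apply, ih]
      rfl
  rw [h']
  exact h i x

/-- The pairing matrix is diagonal with entries `1` and `-1`, hence invertible over every field. -/
theorem wordPairing_dualWord : ∀ i j, wordPairing (dualWord i) (indepWord j) =
    if i = j then (if i = 0 ∨ i = 4 then 1 else -1) else 0 := by
  decide +kernel

theorem linearIndependent_indepWord :
    LinearIndependent K fun i => nicholsMk K (-1) (word K (indepWord i)) := by
  rw [Fintype.linearIndependent_iff]
  intro a ha i
  have h : ∑ j, a j • word K (indepWord j) ∈ wordRadical (-1) := by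
    rw [← nicholsMk_eq_zero, map_sum]
    simpa only [map_smul] using ha
  have h' := (mem_wordRadical _).1 h (dualWord i)
  rw [map_sum, Finset.sum_eq_single i] at h'
  · rw [map_smul, wordForm_word, wordPairing_dualWord, if_pos rfl] at h'
    split_ifs at h' <;> simpa using h'
  · intro j _ hj
    rw [map_smul, wordForm_word, wordPairing_dualWord, if_neg hj.symm, Int.cast_zero, smul_zero]
  · simp

theorem five_le_finrank {W : Submodule K (NicholsAlgebra K fun _ _ : Tetra => (-1 : K))}
    [FiniteDimensional K W]
    (hW : (gradedPart K Rack.act' (1 : Equiv.Perm Tetra)).map (nicholsMk K (-1)) ≤ W) :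
    5 ≤ Module.finrank K W := by
  have hmem : ∀ i, nicholsMk K (-1) (word K (indepWord i)) ∈ W := fun i =>
    hW (Submodule.mem_map_of_mem (Submodule.subset_span ⟨_, prod_indepWord i, rfl⟩))
  have h : LinearIndependent K fun i => (⟨_, hmem i⟩ : W) :=
    LinearIndependent.of_comp W.subtype linearIndependent_indepWord
  simpa using h.fintype_card_le_finrank

end Bounds

/-! ### The enveloping group and its map to the inner group -/

section Envelope

variable {X : Type*} [Rack X]

theorem closure_range_envGen :
    Subgroup.closure (Set.range (envGen : X → Rack.EnvelGroup X)) = ⊤ := by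
  rw [eq_top_iff]
  rintro y -
  induction y using Quotient.inductionOn with
  | h a =>
    induction a with
    | unit => exact one_mem _
    | incl x => exact Subgroup.subset_closure ⟨x, rfl⟩
    | mul a b ha hb => exact mul_mem ha hb
    | inv a ha => exact inv_mem ha

theorem range_envelAction : (Rack.envelAction (R := X)).range = Inn X := by
  rw [MonoidHom.range_eq_map, ← closure_range_envGen, MonoidHom.map_closure, ← Set.range_comp]
  rfl

theorem mul_envGen_mul_inv (y : Rack.EnvelGroup X) (t : X) :
    y * envGen t * y⁻¹ = envGen (Rack.envelAction y t) := by
  have h : y ∈ Subgroup.closure (Set.range (envGen : X → Rack.EnvelGroup X)) := by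
    rw [closure_range_envGen]
    trivial
  have hgen : ∀ s t : X, envGen s * envGen t * (envGen s)⁻¹ = envGen (s ◃ t) := fun s t =>
    (Rack.toEnvelGroup X).map_act.symm
  induction h using Subgroup.closure_induction generalizing t with
  | mem x hx =>
    obtain ⟨s, rfl⟩ := hx
    exact hgen s t
  | one => simp
  | mul x y _ _ hx hy =>
    rw [map_mul, Equiv.Perm.mul_apply, ← hx, ← hy]
    group
  | inv x _ hx =>
    rw [map_inv, inv_inv]
    have := hx ((Rack.envelAction x)⁻¹ t)
    rw [← Equiv.Perm.mul_apply, mul_inv_cancel, Equiv.Perm.one_apply] at this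
    rw [← this]
    group

/-- Conjugation by `y` permutes the generators through the action of `y`, so a trivially acting `y`
is central. -/
theorem commute_of_envelAction_eq_one {y : Rack.EnvelGroup X} (hy : Rack.envelAction y = 1)
    (z : Rack.EnvelGroup X) : Commute y z := by
  have h : z ∈ Subgroup.closure (Set.range (envGen : X → Rack.EnvelGroup X)) := by
    rw [closure_range_envGen]
    trivial
  induction h using Subgroup.closure_induction with
  | mem x hx =>
    obtain ⟨t, rfl⟩ := hx
    have := mul_envGen_mul_inv y t
    rw [hy, Equiv.Perm.one_apply, mul_inv_eq_iff_eq_mul] at this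
    exact this
  | one => exact Commute.one_right y
  | mul a b _ _ ha hb => exact ha.mul_right hb
  | inv a _ ha => exact ha.inv_right

end Envelope

/-- If `p` commutes with `g_t`, then `p t` is fixed by `g_t`, whose only fixed point is `t`. -/
theorem inn_tetra_eq_one {p : Equiv.Perm Tetra} (h : ∀ t, Commute p (Rack.act' t)) : p = 1 := by
  have hfix : ∀ t x : Fin 4, tetraAct t x = x → x = t := by decide +kernel
  ext t
  have h1 : Rack.act' t (p t) = p (Rack.act' t t) := by
    rw [← Equiv.Perm.mul_apply, ← (h t).eq, Equiv.Perm.mul_apply]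
  rw [Rack.act'_apply, Rack.act'_apply, Quandle.fix] at h1
  exact hfix t (p t) h1

/-- Every surjection from the enveloping group of the tetrahedral quandle to the inner group has
the same kernel as the canonical one. -/
theorem ker_eq_ker_envelAction (σ : Rack.EnvelGroup Tetra →* Inn Tetra)
    (hσ : Function.Surjective σ) : σ.ker = (Rack.envelAction (R := Tetra)).ker := by
  have hle : (Rack.envelAction (R := Tetra)).ker ≤ σ.ker := by
    intro y hy
    refine Subtype.ext (inn_tetra_eq_one fun t => ?_)
    obtain ⟨z, hz⟩ := hσ ⟨Rack.act' t, Subgroup.subset_closure ⟨t, rfl⟩⟩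
    have h := ((commute_of_envelAction_eq_one hy z).map σ).map (Inn Tetra).subtype
    rwa [hz] at h
  refine le_antisymm (Subgroup.relIndex_eq_one.1 ?_) hle
  -- Nested kernels with the same finite index, the order of `Inn X`, coincide.
  have h := Subgroup.relIndex_mul_index hle
  rw [Subgroup.index_ker, Subgroup.index_ker, range_envelAction, MonoidHom.range_eq_top.2 hσ,
    Subgroup.card_top] at h
  exact Nat.eq_of_mul_eq_mul_right Nat.card_pos (h.trans (one_mul _).symm)

/-- If `σ = ρ ∘ π` is onto the inner group, then a degree in the fibre of `ρ` over `σ y`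
determines the permutation given by `y`. -/
theorem gradedPart_le_of_fiber {K : Type*} [Field K] {G : Type*} [Group G]
    (π : Rack.EnvelGroup Tetra →* G) (ρ : G →* Inn Tetra)
    (hσ : Function.Surjective (ρ.comp π)) (y : Rack.EnvelGroup Tetra) {g : G}
    (hg : ρ g = ρ (π y)) :
    gradedPart K (fun t => π (envGen t)) g ≤ gradedPart K Rack.act' (Rack.envelAction y) := by
  refine Submodule.span_mono (Set.image_mono fun l hl => ?_)
  rw [Set.mem_ofPred_eq] at hl ⊢
  rw [← map_prod_envGen] at hl
  have h : (l.map envGen).prod * y⁻¹ ∈ (ρ.comp π).ker := by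
    rw [MonoidHom.mem_ker, map_mul, map_inv, MonoidHom.comp_apply, MonoidHom.comp_apply, hl, hg,
      mul_inv_cancel]
  rw [ker_eq_ker_envelAction _ hσ, MonoidHom.mem_ker, map_mul, map_inv, mul_inv_eq_one,
    map_prod_envGen] at h
  exact h

theorem gradedPart_one_le_iSup {K : Type*} [Field K] {G : Type*} [Group G]
    (π : Rack.EnvelGroup Tetra →* G) (ρ : G →* Inn Tetra)
    (hσ : Function.Surjective (ρ.comp π)) :
    gradedPart K Rack.act' (1 : Equiv.Perm Tetra) ≤
      ⨆ g : {g // ρ g = 1}, gradedPart K (fun t => π (envGen t)) g := by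
  refine Submodule.span_le.2 ?_
  rintro _ ⟨l, hl, rfl⟩
  have h : (l.map envGen).prod ∈ (ρ.comp π).ker := by
    rw [ker_eq_ker_envelAction _ hσ, MonoidHom.mem_ker, map_prod_envGen]
    exact hl
  exact Submodule.mem_iSup_of_mem ⟨π (l.map envGen).prod, h⟩
    (Submodule.subset_span ⟨l, (map_prod_envGen π l).symm, rfl⟩)

end RackNichols

/-! ### Comparison of two fibres of `ρ`. -/

open RackNichols in
theorem mainTheorem7 {K : Type*} [Field K] (hK : ringChar K ≠ 2)
    {G : Type*} [Group G]
    (π : Rack.EnvelGroup RackNichols.Tetra →* G) (hπ : Function.Surjective π)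
    (ρ : G →* RackNichols.Inn RackNichols.Tetra) (hρ : Function.Surjective ρ) :
    ¬ RackNichols.IsBalanced K
        (RackNichols.component K (fun _ _ : RackNichols.Tetra => (-1 : K)) π) := by
  rintro ⟨d, hd⟩
  have hfin : ∀ g, FiniteDimensional K (component K (fun _ _ : Tetra => (-1 : K)) π g) :=
    fun g => (hd g).1
  have hσ : Function.Surjective (ρ.comp π) := hρ.comp hπ
  -- The product `g_0 g_1 g_0` is the double transposition `(0 1)(2 3)`.
  let w : List Tetra := ([0, 1, 0] : List (Fin 4))
  let y : Rack.EnvelGroup Tetra := (w.map envGen).prod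
  obtain ⟨hU, hU4⟩ := finrank_le_four K (p := Rack.envelAction y) rfl rfl
  -- Stated for finite subsets because the fibre is not yet known to be finite.
  have hupper : ∀ s : Finset {g // ρ g = ρ (π y)}, s.card * d ≤ 4 := by
    intro s
    let γ : s → G := fun i => i.1.1
    have hγ : Function.Injective γ := Subtype.val_injective.comp Subtype.val_injective
    have hinj := componentSum_injective K (-1) π hγ
    have hrange : LinearMap.range (componentSum K (-1) π γ) ≤
        (gradedPart K Rack.act' (Rack.envelAction y)).map (nicholsMk K (-1)) := by
      rintro _ ⟨x, rfl⟩
      rw [componentSum_apply]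
      refine sum_mem fun i _ => ?_
      exact Submodule.map_mono (gradedPart_le_of_fiber π ρ hσ y i.1.2)
        ((component_eq_map K (-1) π (γ i)).le (x i).2)
    have h := Submodule.finrank_mono hrange
    rw [LinearMap.finrank_range_of_inj hinj, Module.finrank_pi_fintype,
      Finset.sum_congr rfl fun i _ => (hd (γ i)).2, Finset.sum_const, Finset.card_univ,
      Fintype.card_coe, smul_eq_mul] at h
    exact h.trans hU4
  -- The unit of `𝔅` is nonzero, as `ε` detects it, and has trivial degree.
  have hd0 : d ≠ 0 := by
    rintro rfl
    have h1 : nicholsMk (X := Tetra) K (-1) 1 ∈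
        component K (fun _ _ : Tetra => (-1 : K)) π 1 := by
      rw [component_eq_map]
      exact Submodule.mem_map_of_mem (word_mem_gradedPart _ [])
    rw [Submodule.finrank_eq_zero.1 (hd 1).2, Submodule.mem_bot, nicholsMk_eq_zero,
      mem_wordRadical] at h1
    simpa [wordForm_nil] using h1 []
  have hF : Finite {g // ρ g = ρ (π y)} := by
    by_contra hinf
    rw [not_finite_iff_infinite] at hinf
    -- Five distinct degrees in the fibre would give `5 * d ≤ 4` with `d ≥ 1`.
    obtain ⟨s, hs⟩ := Infinite.exists_subset_card_eq {g // ρ g = ρ (π y)} 5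
    have := hupper s
    rw [hs] at this
    omega
  -- Translation by `π y` identifies the two fibres, so the same number of components occurs in both
  -- bounds.
  let e : {g // ρ g = 1} ≃ {g // ρ g = ρ (π y)} :=
    { toFun := fun g => ⟨g.1 * π y, by rw [map_mul, g.2, one_mul]⟩
      invFun := fun g => ⟨g.1 * (π y)⁻¹, by rw [map_mul, g.2, map_inv, mul_inv_cancel]⟩
      left_inv := fun g => Subtype.ext (mul_inv_cancel_right _ _)
      right_inv := fun g => Subtype.ext (inv_mul_cancel_right _ _) }
  have := Fintype.ofFinite {g // ρ g = ρ (π y)}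
  have := Fintype.ofEquiv _ e.symm
  have hle : (gradedPart K Rack.act' (1 : Equiv.Perm Tetra)).map (nicholsMk K (-1)) ≤
      LinearMap.range (componentSum K (-1) π (Subtype.val : {g // ρ g = 1} → G)) := by
    refine (Submodule.map_mono (gradedPart_one_le_iSup π ρ hσ)).trans ?_
    rw [Submodule.map_iSup]
    refine iSup_le fun g => ?_
    rw [← component_eq_map]
    intro x hx
    classical
    refine ⟨Pi.single g ⟨x, hx⟩, ?_⟩
    rw [componentSum_apply, Finset.sum_eq_single g]
    · simp
    · intro g' _ hg'
      rw [Pi.single_eq_of_ne hg', ZeroMemClass.coe_zero]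
    · simp
  have h5 := (five_le_finrank hle).trans (LinearMap.finrank_range_le _)
  rw [Module.finrank_pi_fintype, Finset.sum_congr rfl fun g _ => (hd (Subtype.val g)).2,
    Finset.sum_const, Finset.card_univ, Fintype.card_congr e, smul_eq_mul] at h5
  have h4 := hupper Finset.univ
  rw [Finset.card_univ] at h4
  -- With `n` the common size of the fibres, `5 ≤ n * d` and `n * d ≤ 4`.
  omega

end
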